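/- Let $d,k\ge 2$ be integers, let $\sigma$ be the standard surface measure on the unit sphere $\mathbb S^{d-1}\subset\mathbb R^d$, and for $f\in L^1(\mathbb S^{d-1})$ (complex-valued) put $\widehat{f\sigma}(\xi)=\int_{\mathbb S^{d-1}}e^{-i\zeta\cdot\xi}f(\zeta)\,d\sigma(\zeta)$, $\xi\in\mathbb R^d$. Let $\sigma^{(k)}$ denote the $k$-fold convolution $\sigma*\dots*\sigma$, identified with its Radon--Nikodym derivative with respect to Lebesgue measure on $\mathbb R^d$. Let $f_1,\dots,f_k\in L^1(\mathbb S^{d-1})$ be nonzero (that is, none of them vanishes $\sigma$-a.e.). Then, as an inequality in $[0,\infty]$, $$\Big\|\prod_{j=1}^k\widehat{f_j\sigma}\Big\|_{L^2(\mathbb R^d)}^2\le(2\pi)^d\int_{(\mathbb S^{d-1})^k}\sigma^{(k)}(\zeta_1+\dots+\zeta_k)\prod_{j=1}^k|f_j(\zeta_j)|^2\,d\sigma(\zeta_1)\cdots d\sigma(\zeta_k).$$ Moreover, if $(d,k)\ne(2,2)$ and the right-hand side is finite, then equality holds if and only if there exist $c_1,\dots,c_k\in\mathbb C\setminus\{0\}$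 and a single $\nu\in\mathbb C^d$ such that, for every $j=1,\dots,k$, $f_j(\zeta)=c_je^{\nu\cdot\zeta}$ for $\sigma$-a.e. $\zeta\in\mathbb S^{d-1}$, where $\nu\cdot\zeta=\sum_{i=1}^d\nu_i\zeta_i$. -/

import Mathlib

open MeasureTheory
open scoped ENNReal

noncomputable section

namespace SphereRestriction

/-- The unit sphere `𝕊^{d-1}` of `ℝ^d` (with the Euclidean norm). -/
abbrev Sph (d : ℕ) : Type := Metric.sphere (0 : EuclideanSpace ℝ (Fin d)) 1

/-- The standard surface measure on `𝕊^{d-1}`, of total mass `d` times the volume of the unit ball. -/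
abbrev surf (d : ℕ) : Measure (Sph d) :=
  (volume : Measure (EuclideanSpace ℝ (Fin d))).toSphere

/-- The Fourier transform `ξ ↦ ∫ e^{-i ζ·ξ} f(ζ) dσ(ζ)` of the measure `f σ`. -/
def fourierSurf {d : ℕ} (f : Sph d → ℂ) (ξ : EuclideanSpace ℝ (Fin d)) : ℂ :=
  ∫ ζ, Complex.exp (-Complex.I * (inner ℝ (ζ : EuclideanSpace ℝ (Fin d)) ξ : ℝ)) * f ζ ∂(surf d)

/-- The `k`-fold convolution `σ * ⋯ * σ`, as a Borel measure on `ℝ^d`: the measure of `E` is the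
`σ^k`-measure of the set of `(ζ_1, …, ζ_k)` with `ζ_1 + ⋯ + ζ_k ∈ E`. -/
def surfConv (d k : ℕ) : Measure (EuclideanSpace ℝ (Fin d)) :=
  (Measure.pi fun _ : Fin k => surf d).map fun ζ => ∑ j, (ζ j : EuclideanSpace ℝ (Fin d))

/-- The density (Radon-Nikodym derivative) of the `k`-fold convolution of the surface measure with
respect to Lebesgue measure on `ℝ^d`. -/
def surfConvDensity (d k : ℕ) : EuclideanSpace ℝ (Fin d) → ℝ≥0∞ :=
  (surfConv d k).rnDeriv volume

/-- The right-hand side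
`(2π)^d ∫ σ^{(k)}(ζ_1 + ⋯ + ζ_k) ∏ |f_j(ζ_j)|² dσ(ζ_1) ⋯ dσ(ζ_k)`, with values in `[0, ∞]`. -/
def weightedIntegral {d k : ℕ} (f : Fin k → Sph d → ℂ) : ℝ≥0∞ :=
  ENNReal.ofReal ((2 * Real.pi) ^ d) *
    ∫⁻ ζ : Fin k → Sph d,
      surfConvDensity d k (∑ j, (ζ j : EuclideanSpace ℝ (Fin d))) * ∏ j, ‖f j (ζ j)‖ₑ ^ 2
      ∂(Measure.pi fun _ : Fin k => surf d)

/-- The left-hand side `‖∏ \hat{f_j σ}‖²` in `L²(ℝ^d)`, with values in `[0, ∞]`. -/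
def prodNormSq {d k : ℕ} (f : Fin k → Sph d → ℂ) : ℝ≥0∞ :=
  eLpNorm (fun ξ : EuclideanSpace ℝ (Fin d) => ∏ j, fourierSurf (f j) ξ) 2 volume ^ 2

end SphereRestriction

end

/-
By Plancherel, the left-hand side is a constant times the squared `L²` norm of the conditional
expectation of `√σ⁽ᵏ⁾(∑ ζⱼ) ∏ fⱼ(ζⱼ)` given `∑ ζⱼ`. The inequality is therefore the contractivity of
conditional expectation, and equality holds exactly when `∏ fⱼ(ζⱼ)` is a function of `∑ ζⱼ`.

In the equality case, every test function of `(ζ₁, …, ζₖ)` whose conditional expectation given the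
sum vanishes integrates to zero against `∏ fⱼ(ζⱼ)`. Antisymmetric test functions show that the `fⱼ`
are proportional to one function `f`. Write `M(z) ∈ ℂᵈ` for the gradient of the Laplace transform
of `fσ`. For `f = 1` rotational symmetry makes it proportional to `z`, so that multilinear relations
between the vectors `zᵣ + ζ`, valid for all `ζ`, pass to the vectors `M(zᵣ)`. If `d ≥ 3`, they say
that any two of the lines `z + ℂ M(z)` are coplanar; if `d = 2` and `k ≥ 3`, that any three of them
are concurrent or parallel. As `f ≠ 0`, the vectors `M(z)` span `ℂᵈ`, and all these lines pass
through a common point `p`. Then `e^{p·ζ} f(ζ)` has the same infinitesimal rotation invariance as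
the constants and is itself constant.
-/

namespace SphereRestriction

section Plancherel

open scoped FourierTransform SchwartzMap ContDiff

theorem eLpNorm_two_sq_eq_lintegral {Ω : Type*} [MeasurableSpace Ω] {P : Measure Ω} (g : Ω → ℂ) :
    eLpNorm g 2 P ^ 2 = ∫⁻ x, ‖g x‖ₑ ^ 2 ∂P := by
  simpa using eLpNorm_nnreal_pow_eq_lintegral (f := g) (μ := P) (p := 2) two_ne_zero

variable {E : Type*} [NormedAddCommGroup E] [InnerProductSpace ℝ E] [FiniteDimensional ℝ E]
  [MeasurableSpace E] [BorelSpace E] {F : E → ℂ}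

theorem continuous_fourier (hF : Integrable F) : Continuous (𝓕 F) :=
  VectorFourier.fourierIntegral_continuous Real.continuous_fourierChar
    (by exact continuous_inner) hF

theorem integral_fourier_schwartz_mul_eq (φ : 𝓢(E, ℂ)) (hF : Integrable F) :
    ∫ x, (𝓕 φ) x • F x = ∫ x, φ x • 𝓕 F x := by
  have h := VectorFourier.integral_fourierIntegral_smul_eq_flip (L := innerₗ E) (μ := volume)
    (ν := volume) Real.continuous_fourierChar (by exact continuous_inner) φ.integrable hF
  rwa [flip_innerₗ] at h

theorem coeFn_fourier_toLp_ae_eq (h1 : Integrable F) (h2 : MemLp F 2) :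
    ((𝓕 (h2.toLp F) : Lp ℂ 2 (volume : Measure E)) : E → ℂ) =ᵐ[volume] 𝓕 F := by
  refine ae_eq_of_integral_contDiff_smul_eq ((Lp.memLp _).locallyIntegrable (by norm_num))
    (continuous_fourier h1).locallyIntegrable fun g hg hgc => ?_
  have hgcC : HasCompactSupport (fun x => (g x : ℂ)) := hgc.comp_left Complex.ofReal_zero
  set φ : 𝓢(E, ℂ) := hgcC.toSchwartzMap (Complex.ofRealCLM.contDiff.comp hg)
  have hdist : ∫ x, (𝓕 φ) x • h2.toLp F x = ∫ x, φ x • (𝓕 (h2.toLp F) : Lp ℂ 2 volume) x := by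
    simpa only [TemperedDistribution.fourier_apply, Lp.toTemperedDistribution_apply] using
      congrArg (fun T : 𝓢'(E, ℂ) => T φ) (Lp.fourier_toTemperedDistribution_eq (h2.toLp F))
  have hcoe : ∫ x, (𝓕 φ) x • h2.toLp F x = ∫ x, (𝓕 φ) x • F x :=
    integral_congr_ae (h2.coeFn_toLp.mono fun x hx => congrArg ((𝓕 φ) x • ·) hx)
  exact hdist.symm.trans (hcoe.trans (integral_fourier_schwartz_mul_eq φ h1))

theorem eLpNorm_fourier_eq (h1 : Integrable F) (h2 : MemLp F 2) :
    eLpNorm (𝓕 F) 2 volume = eLpNorm F 2 volume := by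
  rw [← eLpNorm_congr_ae (coeFn_fourier_toLp_ae_eq h1 h2), ← eLpNorm_congr_ae h2.coeFn_toLp,
    ← ENNReal.toReal_eq_toReal_iff' (Lp.eLpNorm_ne_top _) (Lp.eLpNorm_ne_top _),
    ← Lp.norm_def, ← Lp.norm_def, Lp.norm_fourier_eq]

theorem lintegral_comp_inv_smul {g : E → ℝ≥0∞} (hg : Measurable g) {c : ℝ} (hc : 0 < c) :
    ∫⁻ x, g (c⁻¹ • x) = ENNReal.ofReal (c ^ Module.finrank ℝ E) * ∫⁻ x, g x := by
  rw [← lintegral_map hg (measurable_const_smul c⁻¹),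
    Measure.map_addHaar_smul volume (inv_ne_zero hc.ne'), lintegral_smul_measure, smul_eq_mul,
    inv_pow, inv_inv, abs_of_pos (pow_pos hc _)]

end Plancherel

section FourierPush

variable {Ω E : Type*} [MeasurableSpace Ω] {P : Measure Ω} [NormedAddCommGroup E]
  [InnerProductSpace ℝ E]

/-- The Fourier transform `ξ ↦ ∫ e^{-i X·ξ} G dP` of the push-forward of the complex measure `G P`
under `X`. For `X` the inclusion of the sphere it is `fourierSurf`, and for `X = id` on `E` it is
the usual Fourier transform without the factor `2π` in the exponent. -/
noncomputable def fourierPush (P : Measure Ω) (X : Ω → E) (G : Ω → ℂ) (ξ : E) : ℂ :=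
  ∫ ω, Complex.exp (-Complex.I * (inner ℝ (X ω) ξ : ℝ)) * G ω ∂P

theorem norm_exp_neg_I_mul_ofReal (t : ℝ) : ‖Complex.exp (-Complex.I * t)‖ = 1 := by
  simp [Complex.norm_exp]

theorem fourierPush_conj (X : Ω → E) (G : Ω → ℂ) (ξ : E) :
    fourierPush P X (fun ω => (starRingEnd ℂ) (G ω)) ξ
      = (starRingEnd ℂ) (fourierPush P X G (-ξ)) := by
  rw [fourierPush, fourierPush, ← integral_conj]
  simp [← Complex.exp_conj]

theorem fourierPush_const_mul (X : Ω → E) (c : ℂ) (G : Ω → ℂ) (ξ : E) :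
    fourierPush P X (fun ω => c * G ω) ξ = c * fourierPush P X G ξ := by
  simp only [fourierPush, mul_left_comm _ c, integral_const_mul]

variable [MeasurableSpace E] [BorelSpace E] [FiniteDimensional ℝ E] {X : Ω → E}

theorem integrable_exp_mul {G : Ω → ℂ} (hG : Integrable G P) (hX : Measurable X) (ξ : E) :
    Integrable (fun ω => Complex.exp (-Complex.I * (inner ℝ (X ω) ξ : ℝ)) * G ω) P :=
  hG.bdd_mul (c := 1) (by fun_prop) (.of_forall fun _ => (norm_exp_neg_I_mul_ofReal _).le)

theorem fourierPush_add {G H : Ω → ℂ} (hG : Integrable G P) (hH : Integrable H P)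
    (hX : Measurable X) (ξ : E) :
    fourierPush P X (fun ω => G ω + H ω) ξ = fourierPush P X G ξ + fourierPush P X H ξ := by
  simp only [fourierPush, mul_add]
  exact integral_add (integrable_exp_mul hG hX ξ) (integrable_exp_mul hH hX ξ)

theorem fourierPush_finsetSum {ι : Type*} (s : Finset ι) {G : ι → Ω → ℂ}
    (hG : ∀ i ∈ s, Integrable (G i) P) (hX : Measurable X) (ξ : E) :
    fourierPush P X (fun ω => ∑ i ∈ s, G i ω) ξ = ∑ i ∈ s, fourierPush P X (G i) ξ := by
  simp only [fourierPush, Finset.mul_sum]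
  exact integral_finsetSum _ fun i hi => integrable_exp_mul (hG i hi) hX ξ

theorem charFun_map_withDensity {v : Ω → ℝ} (hv : AEMeasurable v P) (hX : Measurable X) (ξ : E) :
    charFun ((P.withDensity fun ω => ENNReal.ofReal (v ω)).map X) ξ
      = fourierPush P X (fun ω => ((max (v ω) 0 : ℝ) : ℂ)) (-ξ) := by
  rw [charFun_apply, integral_map hX.aemeasurable (by fun_prop), fourierPush]
  simp only [ENNReal.ofReal]
  rw [integral_withDensity_eq_integral_smul₀ hv.real_toNNReal]
  congr 1 with ω
  rw [NNReal.smul_def, Real.coe_toNNReal', Complex.real_smul, inner_neg_right]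
  push_cast
  ring_nf

theorem setIntegral_preimage_eq_zero_of_fourierPush_ofReal {v : Ω → ℝ} (hv : Integrable v P)
    (hX : Measurable X) (h : ∀ ξ : E, fourierPush P X (fun ω => v ω) ξ = 0) {B : Set E}
    (hB : MeasurableSet B) : ∫ ω in X ⁻¹' B, v ω ∂P = 0 := by
  have := isFiniteMeasure_withDensity_ofReal hv.2
  have : IsFiniteMeasure (P.withDensity fun ω => ENNReal.ofReal (-v ω)) :=
    isFiniteMeasure_withDensity_ofReal hv.neg.2
  have hmap : (P.withDensity fun ω => ENNReal.ofReal (v ω)).map X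
      = (P.withDensity fun ω => ENNReal.ofReal (-v ω)).map X := by
    refine Measure.ext_of_charFun (funext fun ξ => ?_)
    rw [charFun_map_withDensity hv.1.aemeasurable hX,
      charFun_map_withDensity (v := fun ω => -v ω) hv.1.aemeasurable.neg hX]
    have hsplit := fourierPush_add (G := fun ω => (v ω : ℂ))
      (H := fun ω => ((max (-v ω) 0 : ℝ) : ℂ)) hv.ofReal hv.neg_part.ofReal hX (-ξ)
    rw [h, zero_add] at hsplit
    rw [← hsplit]
    congr 1 with ω
    rw [← Complex.ofReal_add, ← max_add_add_left, add_neg_cancel, add_zero, max_comm]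
  have hBeq := congrArg (fun μ => μ B) hmap
  simp only [Measure.map_apply hX hB, withDensity_apply _ (hX hB)] at hBeq
  rw [integral_eq_lintegral_pos_part_sub_lintegral_neg_part hv.integrableOn, hBeq, sub_self]

theorem setIntegral_preimage_re_eq_zero_of_fourierPush {u : Ω → ℂ} (hu : Integrable u P)
    (hX : Measurable X) (h : ∀ ξ : E, fourierPush P X u ξ = 0) {B : Set E}
    (hB : MeasurableSet B) : ∫ ω in X ⁻¹' B, (u ω).re ∂P = 0 := by
  refine setIntegral_preimage_eq_zero_of_fourierPush_ofReal hu.re hX (fun ξ => ?_) hB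
  have hconj : Integrable (fun ω => (starRingEnd ℂ) (u ω)) P :=
    Complex.conjCLE.toContinuousLinearMap.integrable_comp hu
  simp only [Complex.re_eq_add_conj, div_eq_inv_mul, RCLike.re_to_complex]
  rw [fourierPush_const_mul, fourierPush_add hu hconj hX, fourierPush_conj, h, h]
  simp

theorem setIntegral_preimage_eq_zero_of_fourierPush {u : Ω → ℂ} (hu : Integrable u P)
    (hX : Measurable X) (h : ∀ ξ : E, fourierPush P X u ξ = 0) {B : Set E}
    (hB : MeasurableSet B) : ∫ ω in X ⁻¹' B, u ω ∂P = 0 := by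
  have hre := setIntegral_preimage_re_eq_zero_of_fourierPush hu hX h hB
  have him := setIntegral_preimage_re_eq_zero_of_fourierPush (hu.const_mul (-Complex.I)) hX
    (fun ξ => by rw [fourierPush_const_mul, h, mul_zero]) hB
  simp only [neg_mul, Complex.neg_re, Complex.I_mul_re, neg_neg] at him
  rw [← integral_re_add_im hu.integrableOn]
  simp [hre, him]

theorem condExp_comap_eq_zero_of_fourierPush [IsFiniteMeasure P] {u : Ω → ℂ} (hu : Integrable u P)
    (hX : Measurable X) (h : ∀ ξ : E, fourierPush P X u ξ = 0) :
    P[u | MeasurableSpace.comap X inferInstance] =ᵐ[P] 0 := by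
  refine (ae_eq_condExp_of_forall_setIntegral_eq hX.comap_le hu
    (fun s _ _ => integrableOn_zero) ?_ aestronglyMeasurable_zero).symm
  rintro _ ⟨B, hB, rfl⟩ _
  rw [setIntegral_preimage_eq_zero_of_fourierPush hu hX h hB]
  simp

theorem ae_eq_zero_of_fourierPush {u : Ω → ℂ} (hu : Integrable u P) (hX : MeasurableEmbedding X)
    (h : ∀ ξ : E, fourierPush P X u ξ = 0) : u =ᵐ[P] 0 := by
  refine hu.ae_eq_zero_of_forall_setIntegral_eq_zero fun s hs _ => ?_
  rw [← Set.preimage_image_eq s hX.injective]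
  exact setIntegral_preimage_eq_zero_of_fourierPush hu hX.measurable h
    (hX.measurableSet_image.2 hs)

theorem ae_eq_of_fourierPush_eq {u v : Ω → ℂ} (hu : Integrable u P) (hv : Integrable v P)
    (hX : MeasurableEmbedding X) (h : ∀ ξ : E, fourierPush P X u ξ = fourierPush P X v ξ) :
    u =ᵐ[P] v := by
  have hzero := ae_eq_zero_of_fourierPush (hu.add (hv.const_mul (-1))) hX fun ξ =>
    (fourierPush_add hu (hv.const_mul (-1)) hX.measurable ξ).trans
      (by rw [fourierPush_const_mul, h, neg_one_mul, add_neg_cancel])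
  filter_upwards [hzero] with ω hω
  simpa [add_neg_eq_zero] using hω

theorem integral_mul_eq_zero_of_fourierPush [IsFiniteMeasure P] {G u : Ω → ℂ} (hu : Integrable u P)
    (hX : Measurable X) (h : ∀ ξ : E, fourierPush P X u ξ = 0)
    (hG : AEStronglyMeasurable[MeasurableSpace.comap X inferInstance] G P)
    (hGu : Integrable (fun ω => G ω * u ω) P) : ∫ ω, G ω * u ω ∂P = 0 := by
  rw [← integral_condExp hX.comap_le]
  refine integral_eq_zero_of_ae ?_
  filter_upwards [condExp_comap_eq_zero_of_fourierPush hu hX h,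
    condExp_bilin_of_aestronglyMeasurable_left (ContinuousLinearMap.mul ℝ ℂ) hG hGu hu]
    with ω hzero hpull
  exact hpull.trans (by simp [hzero])

end FourierPush

theorem eLpNorm_condExp_eq_iff {Ω : Type*} {m m₀ : MeasurableSpace Ω} {P : Measure[m₀] Ω}
    [IsFiniteMeasure P] (hm : m ≤ m₀) {g : Ω → ℂ} (hg : MemLp g 2 P) :
    eLpNorm (P[g | m]) 2 P = eLpNorm g 2 P ↔ AEStronglyMeasurable[m] g P := by
  have : Fact (m ≤ m₀) := ⟨hm⟩
  have hproj := Submodule.mem_iff_norm_starProjection (lpMeas ℂ ℂ m 2 P) (hg.toLp g)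
  rw [mem_lpMeas_iff_aestronglyMeasurable, aestronglyMeasurable_congr hg.coeFn_toLp] at hproj
  rw [hproj, ← eLpNorm_congr_ae (hg.condExpL2_ae_eq_condExp (𝕜 := ℂ) hm),
    ← eLpNorm_congr_ae hg.coeFn_toLp,
    ← ENNReal.toReal_eq_toReal_iff' (Lp.eLpNorm_ne_top _) (Lp.eLpNorm_ne_top _),
    ← Lp.norm_def, ← Lp.norm_def]
  rfl

section PushForward

variable {Ω E : Type*} [MeasurableSpace Ω] {P : Measure Ω} [NormedAddCommGroup E]
  [InnerProductSpace ℝ E] [FiniteDimensional ℝ E] [MeasurableSpace E] [BorelSpace E]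
  {X : Ω → E} {G : Ω → ℂ}

open scoped FourierTransform in
theorem eLpNorm_fourierPush_id_sq {F : E → ℂ} (h1 : Integrable F) (h2 : MemLp F 2) :
    eLpNorm (fourierPush volume id F) 2 volume ^ 2
      = ENNReal.ofReal ((2 * Real.pi) ^ Module.finrank ℝ E) * eLpNorm F 2 volume ^ 2 := by
  have hrescale : fourierPush volume id F = fun ξ => 𝓕 F ((2 * Real.pi)⁻¹ • ξ) := by
    ext ξ
    rw [Real.fourier_eq', fourierPush]
    congr 1 with x
    rw [smul_eq_mul, inner_smul_right, id]
    congr 2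
    push_cast
    field_simp
  rw [hrescale, ← eLpNorm_fourier_eq h1 h2, eLpNorm_two_sq_eq_lintegral,
    eLpNorm_two_sq_eq_lintegral]
  exact lintegral_comp_inv_smul ((continuous_fourier h1).measurable.enorm.pow_const 2)
    Real.two_pi_pos

theorem fourierPush_condExp [IsFiniteMeasure P] (hX : Measurable X) (hG : Integrable G P) :
    fourierPush P X (P[G | MeasurableSpace.comap X inferInstance]) = fourierPush P X G := by
  ext ξ
  have hexp : StronglyMeasurable[MeasurableSpace.comap X inferInstance] fun ω =>
      Complex.exp (-Complex.I * (inner ℝ (X ω) ξ : ℝ)) :=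
    ((by fun_prop : Measurable fun x : E =>
      Complex.exp (-Complex.I * (inner ℝ x ξ : ℝ))).comp (comap_measurable X)).stronglyMeasurable
  rw [fourierPush, fourierPush, ← integral_condExp hX.comap_le (f := fun ω => _ * G ω)]
  exact integral_congr_ae (condExp_bilin_of_aestronglyMeasurable_left (ContinuousLinearMap.mul ℝ ℂ)
    hexp.aestronglyMeasurable (integrable_exp_mul hG hX ξ) hG).symm

theorem fourierPush_comp [SigmaFinite (P.map X)] (hX : Measurable X) (hac : P.map X ≪ volume)
    {h : E → ℂ} (hh : Measurable h) :
    fourierPush P X (h ∘ X)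
      = fourierPush volume id fun x => ((P.map X).rnDeriv volume x).toReal • h x := by
  ext ξ
  rw [fourierPush, fourierPush]
  simp only [mul_smul_comm, id]
  rw [integral_rnDeriv_smul hac, integral_map hX.aemeasurable (by fun_prop)]
  rfl

/-- The square root of the density of the law of `X`, evaluated at `X`: the weight which turns
`L²` norms of `G ↦ fourierPush P X G` into `L²(P)` norms of conditional expectations. -/
noncomputable def sqrtDensity (P : Measure Ω) (X : Ω → E) (ω : Ω) : ℝ :=
  Real.sqrt ((P.map X).rnDeriv volume (X ω)).toReal

theorem stronglyMeasurable_sqrtDensity (P : Measure Ω) (X : Ω → E) :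
    StronglyMeasurable[MeasurableSpace.comap X inferInstance] (sqrtDensity P X) :=
  ((Measure.measurable_rnDeriv (P.map X) volume).ennreal_toReal.sqrt.comp
    (comap_measurable X)).stronglyMeasurable

variable [IsFiniteMeasure P]

theorem enorm_sqrtDensity_sq (hX : Measurable X) (hac : P.map X ≪ volume) :
    ∀ᵐ ω ∂P, ‖sqrtDensity P X ω‖ₑ ^ 2 = (P.map X).rnDeriv volume (X ω) := by
  filter_upwards [ae_of_ae_map hX.aemeasurable
    (hac.ae_le (Measure.rnDeriv_lt_top (P.map X) volume))] with ω hω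
  rw [sqrtDensity, Real.enorm_of_nonneg (Real.sqrt_nonneg _), ← ENNReal.ofReal_pow
    (Real.sqrt_nonneg _), Real.sq_sqrt ENNReal.toReal_nonneg, ENNReal.ofReal_toReal hω.ne]

theorem sqrtDensity_ne_zero (hX : Measurable X) (hac : P.map X ≪ volume) :
    ∀ᵐ ω ∂P, sqrtDensity P X ω ≠ 0 := by
  filter_upwards [enorm_sqrtDensity_sq hX hac,
    ae_of_ae_map hX.aemeasurable (Measure.rnDeriv_pos hac)] with ω hsq hpos h0
  rw [h0, enorm_zero, zero_pow two_ne_zero] at hsq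
  exact hpos.ne hsq

theorem eLpNorm_sqrtDensity_smul_sq (hX : Measurable X) (hac : P.map X ≪ volume) (G : Ω → ℂ) :
    eLpNorm (sqrtDensity P X • G) 2 P ^ 2
      = ∫⁻ ω, (P.map X).rnDeriv volume (X ω) * ‖G ω‖ₑ ^ 2 ∂P := by
  rw [eLpNorm_two_sq_eq_lintegral]
  refine lintegral_congr_ae ?_
  filter_upwards [enorm_sqrtDensity_sq hX hac] with ω hω
  rw [Pi.smul_apply', enorm_smul, mul_pow, hω]

theorem eLpNorm_rnDeriv_smul_sq (hX : Measurable X) (hac : P.map X ≪ volume) {h : E → ℂ}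
    (hh : Measurable h) :
    eLpNorm (fun x => ((P.map X).rnDeriv volume x).toReal • h x) 2 volume ^ 2
      = eLpNorm (sqrtDensity P X • (h ∘ X)) 2 P ^ 2 := by
  set ρ := (P.map X).rnDeriv volume
  have hmeas : Measurable fun x => ρ x * ‖h x‖ₑ ^ 2 :=
    (Measure.measurable_rnDeriv _ _).mul (hh.enorm.pow_const 2)
  have hdensity : ∫⁻ x, ‖(ρ x).toReal • h x‖ₑ ^ 2 = ∫⁻ x, ρ x * (ρ x * ‖h x‖ₑ ^ 2) := by
    refine lintegral_congr_ae ?_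
    filter_upwards [Measure.rnDeriv_lt_top (P.map X) volume] with x hx
    rw [enorm_smul, Real.enorm_of_nonneg ENNReal.toReal_nonneg, ENNReal.ofReal_toReal hx.ne]
    ring
  rw [eLpNorm_sqrtDensity_smul_sq hX hac, eLpNorm_two_sq_eq_lintegral, hdensity,
    lintegral_rnDeriv_mul hac hmeas.aemeasurable, lintegral_map hmeas hX]
  rfl

theorem eLpNorm_fourierPush_sq (hX : Measurable X) (hac : P.map X ≪ volume) (hG : Integrable G P)
    (hW : MemLp (sqrtDensity P X • G) 2 P) :
    eLpNorm (fourierPush P X G) 2 volume ^ 2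
      = ENNReal.ofReal ((2 * Real.pi) ^ Module.finrank ℝ E) *
        eLpNorm (P[sqrtDensity P X • G | MeasurableSpace.comap X inferInstance]) 2 P ^ 2 := by
  obtain ⟨h, hh, hGh⟩ := (stronglyMeasurable_condExp (f := G) (μ := P)
    (m := MeasurableSpace.comap X inferInstance)).exists_eq_measurable_comp
  have hh := hh.measurable
  have hpull : P[sqrtDensity P X • G | MeasurableSpace.comap X inferInstance]
      =ᵐ[P] sqrtDensity P X • (h ∘ X) := by
    rw [← hGh]
    exact condExp_smul_of_aestronglyMeasurable_left
      (stronglyMeasurable_sqrtDensity P X).aestronglyMeasurable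
      (memLp_one_iff_integrable.1 (hW.mono_exponent one_le_two)) hG
  have hnorm := eLpNorm_rnDeriv_smul_sq hX hac hh
  have hF1 : Integrable fun x => ((P.map X).rnDeriv volume x).toReal • h x := by
    rw [integrable_rnDeriv_smul_iff hac,
      integrable_map_measure hh.aestronglyMeasurable hX.aemeasurable, ← hGh]
    exact integrable_condExp
  have hF2 : MemLp (fun x => ((P.map X).rnDeriv volume x).toReal • h x) 2 := by
    refine ⟨hF1.1, (ENNReal.pow_lt_top_iff.1 ?_).resolve_right two_ne_zero⟩
    rw [hnorm, ← eLpNorm_congr_ae hpull]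
    exact ENNReal.pow_lt_top (hW.condExp one_le_two).2
  rw [← fourierPush_condExp hX hG, hGh, fourierPush_comp hX hac hh,
    eLpNorm_fourierPush_id_sq hF1 hF2, hnorm, eLpNorm_congr_ae hpull]

theorem aestronglyMeasurable_sqrtDensity_smul_iff (hX : Measurable X) (hac : P.map X ≪ volume) :
    AEStronglyMeasurable[MeasurableSpace.comap X inferInstance] (sqrtDensity P X • G) P ↔
      AEStronglyMeasurable[MeasurableSpace.comap X inferInstance] G P := by
  have hs := stronglyMeasurable_sqrtDensity P X
  refine ⟨fun h => ?_, hs.aestronglyMeasurable.smul⟩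
  refine (hs.measurable.inv.stronglyMeasurable.aestronglyMeasurable.smul h).congr ?_
  filter_upwards [sqrtDensity_ne_zero hX hac] with ω hω
  simp [hω]

theorem memLp_sqrtDensity_smul (hX : Measurable X) (hac : P.map X ≪ volume)
    (hG : Integrable G P) (hW : ∫⁻ ω, (P.map X).rnDeriv volume (X ω) * ‖G ω‖ₑ ^ 2 ∂P ≠ ∞) :
    MemLp (sqrtDensity P X • G) 2 P := by
  refine ⟨((stronglyMeasurable_sqrtDensity P X).mono hX.comap_le).aestronglyMeasurable.smul hG.1,
    (ENNReal.pow_lt_top_iff.1 ?_).resolve_right two_ne_zero⟩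
  rw [eLpNorm_sqrtDensity_smul_sq hX hac]
  exact hW.lt_top

theorem eLpNorm_fourierPush_sq_le (hX : Measurable X) (hac : P.map X ≪ volume)
    (hG : Integrable G P) :
    eLpNorm (fourierPush P X G) 2 volume ^ 2
      ≤ ENNReal.ofReal ((2 * Real.pi) ^ Module.finrank ℝ E) *
        ∫⁻ ω, (P.map X).rnDeriv volume (X ω) * ‖G ω‖ₑ ^ 2 ∂P := by
  by_cases hW : ∫⁻ ω, (P.map X).rnDeriv volume (X ω) * ‖G ω‖ₑ ^ 2 ∂P = ∞
  · rw [hW, ENNReal.mul_top (by positivity)]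
    exact le_top
  · rw [eLpNorm_fourierPush_sq hX hac hG (memLp_sqrtDensity_smul hX hac hG hW),
      ← eLpNorm_sqrtDensity_smul_sq hX hac]
    gcongr
    exact eLpNorm_condExp_le_eLpNorm _ one_le_two

theorem eLpNorm_fourierPush_sq_eq_iff (hX : Measurable X) (hac : P.map X ≪ volume)
    (hG : Integrable G P) (hW : ∫⁻ ω, (P.map X).rnDeriv volume (X ω) * ‖G ω‖ₑ ^ 2 ∂P ≠ ∞) :
    eLpNorm (fourierPush P X G) 2 volume ^ 2
        = ENNReal.ofReal ((2 * Real.pi) ^ Module.finrank ℝ E) *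
          ∫⁻ ω, (P.map X).rnDeriv volume (X ω) * ‖G ω‖ₑ ^ 2 ∂P ↔
      AEStronglyMeasurable[MeasurableSpace.comap X inferInstance] G P := by
  have hmem := memLp_sqrtDensity_smul hX hac hG hW
  rw [eLpNorm_fourierPush_sq hX hac hG hmem, ← eLpNorm_sqrtDensity_smul_sq hX hac,
    ENNReal.mul_right_inj (by positivity) ENNReal.ofReal_ne_top,
    (ENNReal.pow_right_strictMono two_ne_zero).injective.eq_iff,
    eLpNorm_condExp_eq_iff hX.comap_le hmem, aestronglyMeasurable_sqrtDensity_smul_iff hX hac]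

end PushForward

section SurfaceMeasure

variable {E : Type*} [NormedAddCommGroup E] [InnerProductSpace ℝ E] [FiniteDimensional ℝ E]
  [MeasurableSpace E] [BorelSpace E]

variable (E) in
/-- The surface measure of the unit sphere of `E`, regarded as a measure on `E`. -/
noncomputable def surfaceMeasure : Measure E :=
  (volume : Measure E).toSphere.map Subtype.val

instance : IsFiniteMeasure (surfaceMeasure E) := Measure.isFiniteMeasure_map _ _

theorem ae_surfaceMeasure_norm_eq_one : ∀ᵐ x ∂(surfaceMeasure E), ‖x‖ = 1 := by
  rw [surfaceMeasure, ae_map_iff (by fun_prop) (measurableSet_eq_fun measurable_norm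
    measurable_const)]
  exact .of_forall norm_eq_of_mem_sphere

theorem surfaceMeasure_univ_ne_zero [Nontrivial E] : surfaceMeasure E Set.univ ≠ 0 := by
  rw [surfaceMeasure, Measure.map_apply measurable_subtype_coe .univ]
  exact Measure.measure_univ_ne_zero.2 (Measure.toSphere_ne_zero _)

open scoped Pointwise in
theorem surfaceMeasure_apply {s : Set E} (hs : MeasurableSet s) :
    surfaceMeasure E s
      = Module.finrank ℝ E * volume (Set.Ioo (0 : ℝ) 1 • (Metric.sphere 0 1 ∩ s)) := by
  rw [surfaceMeasure, Measure.map_apply measurable_subtype_coe hs,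
    Measure.toSphere_apply' _ (measurable_subtype_coe hs), Subtype.image_preimage_coe]

theorem surfaceMeasure_eq_zero_of_volume_cone {s : Set E} (hs : MeasurableSet s)
    (h : ∀ᵐ x : E, ‖x‖⁻¹ • x ∉ s) : surfaceMeasure E s = 0 := by
  rw [surfaceMeasure_apply hs, mul_eq_zero]
  refine .inr (measure_mono_null ?_ (ae_iff.1 h))
  rintro _ ⟨t, ht, x, ⟨hx, hxs⟩, rfl⟩
  have hx1 : ‖x‖ = 1 := mem_sphere_zero_iff_norm.1 hx
  simpa [norm_smul, hx1, abs_of_pos ht.1, smul_smul, ht.1.ne'] using hxs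

open scoped Pointwise in
theorem map_surfaceMeasure_linearIsometryEquiv (R : E ≃ₗᵢ[ℝ] E) :
    (surfaceMeasure E).map R = surfaceMeasure E := by
  have hR : Measurable R := R.continuous.measurable
  ext s hs
  have hcone : Set.Ioo (0 : ℝ) 1 • (Metric.sphere 0 1 ∩ R ⁻¹' s)
      = R ⁻¹' (Set.Ioo (0 : ℝ) 1 • (Metric.sphere 0 1 ∩ s)) := by
    have hpre (t : Set E) : R ⁻¹' t = R.symm '' t := (R.symm.image_eq_preimage_symm t).symm
    have hsphere : R ⁻¹' Metric.sphere (0 : E) 1 = Metric.sphere 0 1 := by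
      rw [R.preimage_sphere, map_zero]
    nth_rw 1 [← hsphere]
    rw [← Set.preimage_inter, hpre, hpre]
    exact (Set.image_image2_distrib_right R.symm.map_smul).symm
  rw [Measure.map_apply hR hs, surfaceMeasure_apply (hR hs), surfaceMeasure_apply hs, hcone]
  congr 1
  exact R.measurePreserving.measure_preimage_equiv (f := R.toMeasurableEquiv) _

theorem charFun_map_linearIsometryEquiv (μ : Measure E) (R : E ≃ₗᵢ[ℝ] E)
    (ξ : E) : charFun (μ.map R) (R ξ) = charFun μ ξ := by
  rw [charFun_apply, charFun_apply, integral_map (by fun_prop) (by fun_prop)]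
  simp only [R.inner_map_map]

theorem charFun_surfaceMeasure_eq_of_norm_eq {ξ η : E} (h : ‖ξ‖ = ‖η‖) :
    charFun (surfaceMeasure E) ξ = charFun (surfaceMeasure E) η := by
  have hmap := charFun_map_linearIsometryEquiv (surfaceMeasure E)
    ((Submodule.span ℝ {ξ - η})ᗮ.reflection) ξ
  rwa [Submodule.reflection_sub h, map_surfaceMeasure_linearIsometryEquiv, eq_comm] at hmap

theorem integral_charFun_smul_comm (μ ν : Measure E) [IsFiniteMeasure μ] [IsFiniteMeasure ν]
    (r : ℝ) : ∫ x, charFun ν (r • x) ∂μ = ∫ y, charFun μ (r • y) ∂ν := by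
  have hint : Integrable (fun p : E × E =>
      Complex.exp ((inner ℝ p.2 (r • p.1) : ℝ) * Complex.I)) (μ.prod ν) :=
    (integrable_const (1 : ℝ)).mono' (by fun_prop)
      (.of_forall fun p => (Complex.norm_exp_ofReal_mul_I _).le)
  simp only [charFun_apply]
  rw [integral_integral_swap hint]
  simp only [real_inner_smul_right, real_inner_comm]

theorem map_norm_smul_prod_surfaceMeasure (μ : Measure E) [IsFiniteMeasure μ]
    (hμ : ∀ ξ η, ‖ξ‖ = ‖η‖ → charFun μ ξ = charFun μ η) :
    (μ.prod (surfaceMeasure E)).map (fun p => ‖p.1‖ • p.2) = surfaceMeasure E Set.univ • μ := by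
  have := Measure.smul_finite μ (measure_ne_top (surfaceMeasure E) Set.univ)
  have : IsFiniteMeasure ((μ.prod (surfaceMeasure E)).map fun p => ‖p.1‖ • p.2) :=
    Measure.isFiniteMeasure_map _ _
  refine Measure.ext_of_charFun (funext fun ξ => ?_)
  calc charFun ((μ.prod (surfaceMeasure E)).map fun p => ‖p.1‖ • p.2) ξ
      = ∫ x, charFun (surfaceMeasure E) (‖x‖ • ξ) ∂μ := by
        rw [charFun_apply, integral_map (by fun_prop) (by fun_prop), integral_prod]
        · simp only [charFun_apply, real_inner_smul_left, real_inner_smul_right]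
        · exact (integrable_const (1 : ℝ)).mono' (by fun_prop)
            (.of_forall fun p => (Complex.norm_exp_ofReal_mul_I _).le)
    _ = ∫ x, charFun (surfaceMeasure E) (‖ξ‖ • x) ∂μ := by
        congr 1 with x
        exact charFun_surfaceMeasure_eq_of_norm_eq (by simp [norm_smul, mul_comm])
    _ = ∫ y, charFun μ (‖ξ‖ • y) ∂(surfaceMeasure E) := integral_charFun_smul_comm μ _ _
    _ = ∫ _, charFun μ ξ ∂(surfaceMeasure E) := by
        refine integral_congr_ae ?_
        filter_upwards [ae_surfaceMeasure_norm_eq_one] with y hy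
        exact hμ _ _ (by simp [norm_smul, hy])
    _ = charFun (surfaceMeasure E Set.univ • μ) ξ := by
        rw [integral_const, charFun_apply, charFun_apply, integral_smul_measure]
        rfl

theorem ae_surfaceMeasure_smul_preimage_eq_zero {N : Set E} (hN : MeasurableSet N)
    (h0 : volume N = 0) :
    ∀ᵐ r : ℝ, 0 < r → surfaceMeasure E {x | r • x ∈ N} = 0 := by
  have hmp := Measure.measurePreserving_homeomorphUnitSphereProd (volume : Measure E)
  set A : Set (Metric.sphere (0 : E) 1 × Set.Ioi (0 : ℝ)) := {p | (p.2 : ℝ) • (p.1 : E) ∈ N}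
  have hA : MeasurableSet A := by measurability
  have hA0 : ((volume : Measure E).toSphere.prod
      (Measure.volumeIoiPow (Module.finrank ℝ E - 1))) A = 0 := by
    have hpre : homeomorphUnitSphereProd E ⁻¹' A = Subtype.val ⁻¹' N := by
      ext x
      simp [A, smul_smul, norm_ne_zero_iff.2 x.2]
    rw [← hmp.measure_preimage hA.nullMeasurableSet, hpre,
      comap_subtype_coe_apply (measurableSet_singleton _).compl]
    exact measure_mono_null (Set.image_preimage_subset _ _) h0
  rw [Measure.prod_apply_symm hA, lintegral_eq_zero_iff (measurable_measure_prodMk_right hA),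
    Measure.volumeIoiPow, Filter.EventuallyEq, ae_withDensity_iff (by fun_prop)] at hA0
  refine (ae_restrict_iff' measurableSet_Ioi).1 ((ae_restrict_iff_subtype measurableSet_Ioi).2 ?_)
  filter_upwards [hA0] with r hr
  rw [surfaceMeasure, Measure.map_apply measurable_subtype_coe (by measurability)]
  exact hr (by simpa using pow_pos (Set.mem_Ioi.1 r.2) _)

theorem absolutelyContinuous_of_charFun_radial [Nontrivial E] {μ : Measure E} [IsFiniteMeasure μ]
    (hμ : ∀ ξ η, ‖ξ‖ = ‖η‖ → charFun μ ξ = charFun μ η) (hn : μ.map norm ≪ volume) :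
    μ ≪ volume := by
  refine Measure.AbsolutelyContinuous.mk fun N hN h0 => ?_
  have hm : MeasurableSet ((fun p : E × E => ‖p.1‖ • p.2) ⁻¹' N) := by measurability
  have hradius : ∀ᵐ x ∂μ, (0 < ‖x‖ → surfaceMeasure E {y | ‖x‖ • y ∈ N} = 0) ∧ ‖x‖ ≠ 0 :=
    ae_of_ae_map measurable_norm.aemeasurable (hn.ae_le
      ((ae_surfaceMeasure_smul_preimage_eq_zero hN h0).and (Measure.ae_ne volume 0)))
  have hnull : (surfaceMeasure E Set.univ • μ) N = 0 := by
    rw [← map_norm_smul_prod_surfaceMeasure μ hμ, Measure.map_apply (by fun_prop) hN,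
      Measure.measure_prod_null hm]
    filter_upwards [hradius] with x hx using hx.1 ((norm_nonneg x).lt_of_ne' hx.2)
  exact (mul_eq_zero.1 hnull).resolve_left surfaceMeasure_univ_ne_zero

theorem volume_add_div_sqrt_mem_eq_zero {N : Set ℝ} (h0 : volume N = 0) (s : ℝ) {ρ : ℝ}
    (hρ : 0 < ρ) :
    volume {t : ℝ | (s + t) / √(ρ ^ 2 + (s + t) ^ 2) ∈ N} = 0 := by
  refine measure_mono_null (t := (fun w => ρ * OpenPartialHomeomorph.univUnitBall.symm w - s) ''
    (N ∩ Metric.ball 0 1)) (fun t ht => ?_) ?_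
  · have hw : OpenPartialHomeomorph.univUnitBall ((s + t) / ρ)
        = (s + t) / √(ρ ^ 2 + (s + t) ^ 2) := by
      have hsqrt : √(1 + ‖(s + t) / ρ‖ ^ 2) = √(ρ ^ 2 + (s + t) ^ 2) / ρ := by
        rw [eq_div_iff hρ.ne', ← Real.sqrt_sq hρ.le, ← Real.sqrt_mul (by positivity),
          Real.sqrt_sq hρ.le, Real.norm_eq_abs, sq_abs]
        field_simp
      rw [OpenPartialHomeomorph.univUnitBall_apply, hsqrt, smul_eq_mul]
      field_simp
    refine ⟨OpenPartialHomeomorph.univUnitBall ((s + t) / ρ), ⟨hw ▸ ht, ?_⟩, ?_⟩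
    · exact OpenPartialHomeomorph.univUnitBall.map_source (Set.mem_univ _)
    · simp only [OpenPartialHomeomorph.univUnitBall.left_inv (Set.mem_univ ((s + t) / ρ))]
      field_simp
      ring
  · refine addHaar_image_eq_zero_of_differentiableOn_of_addHaar_eq_zero volume ?_
      (measure_mono_null Set.inter_subset_left h0)
    have := OpenPartialHomeomorph.contDiffOn_univUnitBall_symm (E := ℝ) (n := 1)
    exact (((this.differentiableOn one_ne_zero).mono
      Set.inter_subset_right).const_mul ρ).sub_const s

theorem ae_inner_normalize_notMem (hE : 2 ≤ Module.finrank ℝ E) {a : E}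
    (ha : ‖a‖ = 1) {N : Set ℝ} (hN : MeasurableSet N) (h0 : volume N = 0) :
    ∀ᵐ x : E, inner ℝ a (‖x‖⁻¹ • x) ∉ N := by
  have hspan : ∀ᵐ y : E, y ∉ ℝ ∙ a := by
    refine compl_mem_ae_iff.2 (Measure.addHaar_submodule _ _ fun htop => ?_)
    have := finrank_span_le_card (R := ℝ) ({a} : Set E)
    rw [htop, finrank_top, Set.toFinset_card, Fintype.card_unique] at this
    lia
  refine (ae_ae_add_linearMap_mem_iff (LinearMap.toSpanSingleton ℝ _ a) volume volume
    (s := {x : E | inner ℝ a (‖x‖⁻¹ • x) ∉ N}) (by measurability)).1 ?_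
  filter_upwards [hspan] with y hy
  set s : ℝ := inner ℝ a y with hs
  set z : E := y - s • a with hz
  have hzpos : 0 < ‖z‖ := by
    refine norm_pos_iff.2 fun h => hy ?_
    exact Submodule.mem_span_singleton.2 ⟨s, (sub_eq_zero.1 h).symm⟩
  have haz : inner ℝ a z = 0 := by
    rw [hz, inner_sub_right, inner_smul_right, real_inner_self_eq_norm_sq, ha, ← hs]
    ring
  have hline (t : ℝ) : y + t • a = z + (s + t) • a := by rw [hz]; module
  have hnorm (t : ℝ) : ‖z + (s + t) • a‖ = √(‖z‖ ^ 2 + (s + t) ^ 2) := by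
    rw [← Real.sqrt_sq (norm_nonneg (z + (s + t) • a)), norm_add_sq_real, norm_smul, ha,
      inner_smul_right, real_inner_comm, haz, Real.norm_eq_abs, mul_one, sq_abs]
    ring_nf
  filter_upwards [compl_mem_ae_iff.2 (volume_add_div_sqrt_mem_eq_zero h0 s hzpos)] with t ht
  rw [LinearMap.toSpanSingleton_apply, hline, hnorm, inner_smul_right,
    inner_add_right, haz, inner_smul_right, real_inner_self_eq_norm_sq, ha]
  simpa [div_eq_inv_mul] using ht

theorem surfaceMeasure_inner_mem_eq_zero (hE : 2 ≤ Module.finrank ℝ E) {a : E}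
    (ha : ‖a‖ = 1) {N : Set ℝ} (h0 : volume N = 0) :
    surfaceMeasure E {x | inner ℝ a x ∈ N} = 0 := by
  have hN := measurableSet_toMeasurable volume N
  refine measure_mono_null (fun x hx => subset_toMeasurable volume N hx)
    (surfaceMeasure_eq_zero_of_volume_cone (s := {x | inner ℝ a x ∈ toMeasurable volume N})
      (by measurability) (ae_inner_normalize_notMem hE ha hN ((measure_toMeasurable N).trans h0)))

theorem surfaceMeasure_norm_add_mem_eq_zero (hE : 2 ≤ Module.finrank ℝ E) {a : E}
    (ha : ‖a‖ = 1) {N : Set ℝ} (h0 : volume N = 0) :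
    surfaceMeasure E {x | ‖a + x‖ ∈ N} = 0 := by
  have himage : volume ((fun r : ℝ => r ^ 2 / 2 - 1) '' N) = 0 :=
    addHaar_image_eq_zero_of_differentiableOn_of_addHaar_eq_zero volume (by fun_prop) h0
  refine measure_mono_null_ae ?_ (surfaceMeasure_inner_mem_eq_zero hE ha himage)
  filter_upwards [ae_surfaceMeasure_norm_eq_one] with x hx hxN
  refine ⟨‖a + x‖, hxN, ?_⟩
  simp only [norm_add_sq_real, ha, hx]
  ring

theorem conv_surfaceMeasure_absolutelyContinuous (hE : 2 ≤ Module.finrank ℝ E) :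
    Measure.conv (surfaceMeasure E) (surfaceMeasure E) ≪ volume := by
  have : Nontrivial E := Module.nontrivial_of_finrank_pos (R := ℝ) (by lia)
  refine absolutelyContinuous_of_charFun_radial (fun ξ η h => ?_)
    (Measure.AbsolutelyContinuous.mk fun M hM h0 => ?_)
  · rw [charFun_conv, charFun_conv, charFun_surfaceMeasure_eq_of_norm_eq h]
  · have hnorm : MeasurableSet (norm ⁻¹' M : Set E) := measurable_norm hM
    rw [Measure.map_apply measurable_norm hM, Measure.conv, Measure.map_apply (by fun_prop) hnorm,
      Measure.measure_prod_null (by measurability)]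
    filter_upwards [ae_surfaceMeasure_norm_eq_one] with a ha
    exact surfaceMeasure_norm_add_mem_eq_zero hE ha h0

end SurfaceMeasure

theorem fourierPush_pi_sum {ι E : Type*} [Fintype ι] [NormedAddCommGroup E]
    [InnerProductSpace ℝ E] {Ω : ι → Type*} [∀ i, MeasurableSpace (Ω i)] (P : ∀ i, Measure (Ω i))
    [∀ i, SigmaFinite (P i)] (X : ∀ i, Ω i → E) (f : ∀ i, Ω i → ℂ) (ξ : E) :
    fourierPush (Measure.pi P) (fun ω => ∑ i, X i (ω i)) (fun ω => ∏ i, f i (ω i)) ξ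
      = ∏ i, fourierPush (P i) (X i) (f i) ξ := by
  simp only [fourierPush, sum_inner, Complex.ofReal_sum, Finset.mul_sum, Complex.exp_sum,
    ← Finset.prod_mul_distrib]
  exact integral_fintype_prod_eq_prod (f := fun i ω =>
    Complex.exp (-Complex.I * (inner ℝ (X i ω) ξ : ℝ)) * f i ω)

theorem charFun_map_eq_fourierPush {Ω E : Type*} [MeasurableSpace Ω] {P : Measure Ω}
    [NormedAddCommGroup E] [InnerProductSpace ℝ E] [MeasurableSpace E] [BorelSpace E]
    [FiniteDimensional ℝ E] {X : Ω → E} (hX : Measurable X) (ξ : E) :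
    charFun (P.map X) ξ = fourierPush P X (fun _ => 1) (-ξ) := by
  rw [charFun_apply, integral_map hX.aemeasurable (by fun_prop), fourierPush]
  simp [mul_comm Complex.I]

section SurfConv

variable {d k : ℕ}

theorem charFun_surfConv (ξ : EuclideanSpace ℝ (Fin d)) :
    charFun (surfConv d k) ξ
      = charFun (surfaceMeasure (EuclideanSpace ℝ (Fin d))) ξ ^ k := by
  rw [surfConv, charFun_map_eq_fourierPush (by fun_prop), surfaceMeasure,
    charFun_map_eq_fourierPush measurable_subtype_coe]
  simpa using fourierPush_pi_sum (fun _ : Fin k => surf d) (fun _ => Subtype.val)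
    (fun _ _ => (1 : ℂ)) (-ξ)

instance : IsFiniteMeasure (surfConv d k) := Measure.isFiniteMeasure_map _ _

theorem surfConv_add_eq_conv (m n : ℕ) :
    surfConv d (m + n) = Measure.conv (surfConv d m) (surfConv d n) :=
  Measure.ext_of_charFun (funext fun ξ => by
    rw [charFun_conv, charFun_surfConv, charFun_surfConv, charFun_surfConv, pow_add])

theorem surfConv_two_eq_conv : surfConv d 2 =
    Measure.conv (surfaceMeasure (EuclideanSpace ℝ (Fin d))) (surfaceMeasure _) :=
  Measure.ext_of_charFun (funext fun ξ => by rw [charFun_conv, charFun_surfConv, sq])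

theorem surfConv_absolutelyContinuous (hd : 2 ≤ d) (hk : 2 ≤ k) : surfConv d k ≪ volume := by
  obtain ⟨m, rfl⟩ := Nat.exists_eq_add_of_le' hk
  rw [surfConv_add_eq_conv, surfConv_two_eq_conv]
  exact Measure.conv_absolutelyContinuous
    (conv_surfaceMeasure_absolutelyContinuous (by simpa using hd))

/-- The product `∏ⱼ fⱼ(ζⱼ)` is almost everywhere a measurable function of `∑ⱼ ζⱼ`. -/
def IsFunctionOfSum {ι : Type*} [Fintype ι] (f : ι → Sph d → ℂ) : Prop :=
  AEStronglyMeasurable[MeasurableSpace.comap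
    (fun ζ : ι → Sph d => ∑ j, (ζ j : EuclideanSpace ℝ (Fin d))) inferInstance]
    (fun ζ => ∏ j, f j (ζ j)) (Measure.pi fun _ => surf d)

theorem prodNormSq_eq_eLpNorm_fourierPush (f : Fin k → Sph d → ℂ) :
    prodNormSq f = eLpNorm (fourierPush (Measure.pi fun _ : Fin k => surf d)
      (fun ζ => ∑ j, (ζ j : EuclideanSpace ℝ (Fin d))) fun ζ => ∏ j, f j (ζ j)) 2 volume ^ 2 := by
  rw [prodNormSq]
  congr! 3 with ξ
  exact (fourierPush_pi_sum _ (fun _ => Subtype.val) f ξ).symm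

theorem weightedIntegral_eq_lintegral_enorm_prod (f : Fin k → Sph d → ℂ) :
    weightedIntegral f = ENNReal.ofReal ((2 * Real.pi) ^
        Module.finrank ℝ (EuclideanSpace ℝ (Fin d))) *
      ∫⁻ ζ : Fin k → Sph d, (surfConv d k).rnDeriv volume
          (∑ j, (ζ j : EuclideanSpace ℝ (Fin d))) * ‖∏ j, f j (ζ j)‖ₑ ^ 2
        ∂(Measure.pi fun _ : Fin k => surf d) := by
  simp only [weightedIntegral, surfConvDensity, finrank_euclideanSpace_fin, enorm_eq_nnnorm,
    nnnorm_prod, ENNReal.ofNNReal_finsetProd, Finset.prod_pow]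

theorem prodNormSq_le_weightedIntegral (hd : 2 ≤ d) (hk : 2 ≤ k) {f : Fin k → Sph d → ℂ}
    (hf : ∀ j, Integrable (f j) (surf d)) : prodNormSq f ≤ weightedIntegral f := by
  rw [prodNormSq_eq_eLpNorm_fourierPush, weightedIntegral_eq_lintegral_enorm_prod]
  exact eLpNorm_fourierPush_sq_le (by fun_prop) (surfConv_absolutelyContinuous hd hk)
    (Integrable.fintype_prod hf)

theorem prodNormSq_eq_weightedIntegral_iff (hd : 2 ≤ d) (hk : 2 ≤ k) {f : Fin k → Sph d → ℂ}
    (hf : ∀ j, Integrable (f j) (surf d)) (hW : weightedIntegral f ≠ ∞) :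
    prodNormSq f = weightedIntegral f ↔ IsFunctionOfSum f := by
  rw [weightedIntegral_eq_lintegral_enorm_prod] at hW ⊢
  rw [prodNormSq_eq_eLpNorm_fourierPush]
  exact eLpNorm_fourierPush_sq_eq_iff (by fun_prop) (surfConv_absolutelyContinuous hd hk)
    (Integrable.fintype_prod hf) (ENNReal.lt_top_of_mul_ne_top_right hW (by positivity)).ne

end SurfConv

section Rotation

theorem integrable_smul_of_compactSpace {X F : Type*} [TopologicalSpace X] [CompactSpace X]
    [MeasurableSpace X] [BorelSpace X] [SecondCountableTopology X] {μ : Measure X}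
    [NormedAddCommGroup F] [NormedSpace ℂ F] {u : X → ℂ} (hu : Integrable u μ) {φ : X → F}
    (hφ : Continuous φ) : Integrable (fun x => u x • φ x) μ := by
  obtain ⟨C, hC⟩ := isCompact_univ.exists_bound_of_continuousOn hφ.continuousOn
  refine (hu.norm.mul_const C).mono (hu.aestronglyMeasurable.smul hφ.aestronglyMeasurable)
    (.of_forall fun x => ?_)
  rw [norm_smul, norm_mul, norm_norm]
  gcongr
  exact (hC x (Set.mem_univ x)).trans (Real.le_norm_self C)

theorem hasFDerivAt_integral_mul_of_compactSpace {X H : Type*} [TopologicalSpace X] [CompactSpace X]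
    [MeasurableSpace X] [BorelSpace X] [SecondCountableTopology X] {μ : Measure X}
    [NormedAddCommGroup H] [NormedSpace ℝ H] [ProperSpace H] {u : X → ℂ} (hu : Integrable u μ)
    {φ : H → X → ℂ} {φ' : H → X → H →L[ℝ] ℂ} (hφ : ∀ h, Continuous (φ h))
    (hφ' : Continuous (Function.uncurry φ')) (hderiv : ∀ h x, HasFDerivAt (φ · x) (φ' h x) h)
    (h₀ : H) :
    HasFDerivAt (fun h => ∫ x, u x * φ h x ∂μ) (∫ x, u x • φ' h₀ x ∂μ) h₀ := by
  obtain ⟨K, hK⟩ := ((isCompact_closedBall h₀ 1).prod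
    (isCompact_univ (X := X))).exists_bound_of_continuousOn hφ'.continuousOn
  refine hasFDerivAt_integral_of_dominated_of_fderiv_le (Metric.ball_mem_nhds h₀ one_pos)
    (.of_forall fun h => (integrable_smul_of_compactSpace hu (hφ h)).aestronglyMeasurable)
    (integrable_smul_of_compactSpace hu (hφ h₀))
    (integrable_smul_of_compactSpace hu (by fun_prop)).aestronglyMeasurable
    (.of_forall fun x h hh => ?_) (hu.norm.mul_const K)
    (.of_forall fun x h _ => (hderiv h x).const_mul (u x))
  rw [norm_smul]
  gcongr
  exact hK (h, x) ⟨Metric.ball_subset_closedBall hh, Set.mem_univ x⟩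

theorem eq_of_norm_eq_of_fderiv_eq_zero_of_inner_eq_zero {E : Type*} [NormedAddCommGroup E]
    [InnerProductSpace ℝ E] (hE : 2 ≤ Module.finrank ℝ E) {f : E → ℂ} (hf : Differentiable ℝ f)
    (h : ∀ x ≠ 0, ∀ v, inner ℝ x v = 0 → fderiv ℝ f x v = 0) {x y : E} (hxy : ‖x‖ = ‖y‖) :
    f x = f y := by
  rcases eq_or_ne x 0 with rfl | hx
  · rw [norm_zero, eq_comm, norm_eq_zero] at hxy
    rw [hxy]
  have hy : y ≠ 0 := norm_ne_zero_iff.1 (hxy ▸ norm_ne_zero_iff.2 hx)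
  set N : E → E := fun z => (‖x‖ / ‖z‖) • z with hN
  have hNd {z : E} (hz : z ≠ 0) : DifferentiableAt ℝ N z := by
    have := norm_ne_zero_iff.2 hz
    have := (contDiffAt_norm ℝ (n := 1) hz).differentiableAt one_ne_zero
    fun_prop (disch := assumption)
  have hNnorm {z : E} (hz : z ≠ 0) : ‖N z‖ = ‖x‖ := by
    simp [hN, norm_smul, div_mul_cancel₀ _ (norm_ne_zero_iff.2 hz)]
  have hNne {z : E} (hz : z ≠ 0) : N z ≠ 0 := by
    rwa [← norm_ne_zero_iff, hNnorm hz, norm_ne_zero_iff]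
  have hNperp {z : E} (hz : z ≠ 0) (v : E) : inner ℝ (N z) (fderiv ℝ N z v) = 0 := by
    have h1 := (hNd hz).hasFDerivAt.norm_sq
    have h2 : HasFDerivAt (fun w => ‖N w‖ ^ 2) (0 : E →L[ℝ] ℝ) z :=
      (hasFDerivAt_const (‖x‖ ^ 2) z).congr_of_eventuallyEq
        ((isOpen_ne.eventually_mem hz).mono fun w hw => congrArg (· ^ 2) (hNnorm hw))
    simpa using congr($(h1.unique h2) v)
  have hcomp {z : E} (hz : z ≠ 0) : HasFDerivAt (f ∘ N) (0 : E →L[ℝ] ℂ) z := by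
    refine ((hf (N z)).hasFDerivAt.comp z (hNd hz).hasFDerivAt).congr_fderiv ?_
    ext1 v
    exact h _ (hNne hz) _ (hNperp hz v)
  have hconn : IsConnected ({0}ᶜ : Set E) := isConnected_compl_singleton_of_one_lt_rank
    (Module.lt_rank_of_lt_finrank hE) 0
  have := isOpen_compl_singleton.is_const_of_fderiv_eq_zero hconn.isPreconnected
    (fun z hz => (hcomp hz).differentiableAt.differentiableWithinAt)
    (fun z hz => (hcomp hz).fderiv) hx hy
  simpa [hN, hxy, hx, hy] using this

variable {E : Type*} [NormedAddCommGroup E] [InnerProductSpace ℝ E] [FiniteDimensional ℝ E]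
  [MeasurableSpace E] [BorelSpace E]

theorem integral_toSphere_comp_linearIsometryEquiv (R : E ≃ₗᵢ[ℝ] E) {φ : E → ℂ}
    (hφ : Continuous φ) :
    ∫ a : Metric.sphere (0 : E) 1, φ (R a) ∂(volume : Measure E).toSphere
      = ∫ a : Metric.sphere (0 : E) 1, φ a ∂(volume : Measure E).toSphere := by
  have h := congrArg (fun μ : Measure E => ∫ x, φ x ∂μ)
    (map_surfaceMeasure_linearIsometryEquiv (E := E) R)
  rwa [integral_map R.continuous.aemeasurable hφ.aestronglyMeasurable, surfaceMeasure,
    integral_map measurable_subtype_coe.aemeasurable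
      (f := fun x => φ (R x)) (hφ.comp R.continuous).aestronglyMeasurable,
    integral_map measurable_subtype_coe.aemeasurable hφ.aestronglyMeasurable] at h

theorem integral_toSphere_fderiv_skewAdjoint {A : E →L[ℝ] E} (hA : A ∈ skewAdjoint (E →L[ℝ] E))
    {φ : E → ℂ} (hφ : ContDiff ℝ 1 φ) :
    ∫ a : Metric.sphere (0 : E) 1, fderiv ℝ φ a (A a) ∂(volume : Measure E).toSphere = 0 := by
  have : NormedAlgebra ℚ (E →L[ℝ] E) := NormedAlgebra.restrictScalars ℚ ℝ _
  set R : ℝ → E →L[ℝ] E := fun t => NormedSpace.exp (t • A)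
  have hR (t : ℝ) : HasDerivAt R (A * R t) t := hasDerivAt_exp_smul_const' A t
  have : Continuous R := continuous_iff_continuousAt.2 fun t => (hR t).continuousAt
  have hconst (t : ℝ) : ∫ a : Metric.sphere (0 : E) 1, φ (R t a) ∂(volume : Measure E).toSphere
      = ∫ a : Metric.sphere (0 : E) 1, φ a ∂(volume : Measure E).toSphere :=
    integral_toSphere_comp_linearIsometryEquiv (Unitary.linearIsometryEquiv
      ⟨R t, NormedSpace.exp_mem_unitary_of_mem_skewAdjoint (skewAdjoint.smul_mem t hA)⟩)
      hφ.continuous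
  have hderiv (t : ℝ) (a : E) : HasFDerivAt (fun s => φ (R s a))
      (ContinuousLinearMap.toSpanSingletonCLE (fderiv ℝ φ (R t a) (A (R t a)))) t :=
    ((hφ.differentiable one_ne_zero _).hasFDerivAt.comp_hasDerivAt t
      (((hR t).clm_apply (hasDerivAt_const t a)).congr_deriv (by simp))).hasFDerivAt
  have hcont : Continuous fun p : ℝ × Metric.sphere (0 : E) 1 =>
      fderiv ℝ φ (R p.1 p.2) (A (R p.1 p.2)) := by
    have := hφ.continuous_fderiv one_ne_zero
    fun_prop
  have hint := hasFDerivAt_integral_mul_of_compactSpace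
    (integrable_const (μ := (volume : Measure E).toSphere) (1 : ℂ))
    (φ := fun t (a : Metric.sphere (0 : E) 1) => φ (R t a))
    (φ' := fun t a => ContinuousLinearMap.toSpanSingletonCLE (fderiv ℝ φ (R t a) (A (R t a))))
    (fun t => hφ.continuous.comp (by fun_prop))
    (ContinuousLinearMap.toSpanSingletonCLE.continuous.comp hcont)
    (fun t a => hderiv t a) 0
  simp only [one_mul, one_smul, hconst] at hint
  rw [ContinuousLinearEquiv.integral_comp_comm] at hint
  simpa [R] using congr($(hint.unique (hasFDerivAt_const _ _)) 1)

theorem hasFDerivAt_fourierPush_toSphere {u : Metric.sphere (0 : E) 1 → ℂ}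
    (hu : Integrable u (volume : Measure E).toSphere) (ξ : E) :
    HasFDerivAt (fourierPush (volume : Measure E).toSphere Subtype.val u)
      (∫ a : Metric.sphere (0 : E) 1, u a • (Complex.exp (-Complex.I * (inner ℝ (a : E) ξ : ℝ)) •
        (-Complex.I) • Complex.ofRealCLM.comp (innerSL ℝ (a : E))) ∂(volume : Measure E).toSphere)
      ξ := by
  set φ' : E → Metric.sphere (0 : E) 1 → E →L[ℝ] ℂ := fun ξ a =>
    Complex.exp (-Complex.I * (inner ℝ (a : E) ξ : ℝ)) •
      (-Complex.I) • Complex.ofRealCLM.comp (innerSL ℝ (a : E))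
  have hφ' : Continuous (Function.uncurry φ') := by fun_prop
  refine (hasFDerivAt_integral_mul_of_compactSpace hu
    (φ := fun ξ a => Complex.exp (-Complex.I * (inner ℝ (a : E) ξ : ℝ))) (fun ξ => by fun_prop)
    hφ' (fun ξ a => ?_) ξ).congr_of_eventuallyEq (.of_forall fun η => ?_)
  · exact ((Complex.ofRealCLM.comp (innerSL ℝ (a : E))).hasFDerivAt.const_mul (-Complex.I)).cexp
  · simp only [fourierPush, mul_comm (u _)]

theorem fderiv_fourierPush_toSphere_apply {u : Metric.sphere (0 : E) 1 → ℂ}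
    (hu : Integrable u (volume : Measure E).toSphere) (ξ v : E) :
    fderiv ℝ (fourierPush (volume : Measure E).toSphere Subtype.val u) ξ v
      = -Complex.I * ∫ a : Metric.sphere (0 : E) 1, u a * ((inner ℝ (a : E) v : ℝ) *
        Complex.exp (-Complex.I * (inner ℝ (a : E) ξ : ℝ))) ∂(volume : Measure E).toSphere := by
  rw [(hasFDerivAt_fourierPush_toSphere hu ξ).fderiv, ContinuousLinearMap.integral_apply,
    ← integral_const_mul]
  · congr with a
    simp
    ring
  · exact integrable_smul_of_compactSpace hu (by fun_prop)

theorem integral_fourierPush_mul_comm {Ω Ω' : Type*} [MeasurableSpace Ω] [MeasurableSpace Ω']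
    {P : Measure Ω} {Q : Measure Ω'} [SFinite P] [SFinite Q] {X : Ω → E} {Y : Ω' → E}
    (hX : Measurable X) (hY : Measurable Y) {u : Ω → ℂ} {v : Ω' → ℂ} (hu : Integrable u P)
    (hv : Integrable v Q) :
    ∫ ω', fourierPush P X u (Y ω') * v ω' ∂Q = ∫ ω, fourierPush Q Y v (X ω) * u ω ∂P := by
  have hint : Integrable (fun p : Ω' × Ω =>
      Complex.exp (-Complex.I * (inner ℝ (X p.2) (Y p.1) : ℝ)) * u p.2 * v p.1) (Q.prod P) := by
    refine ((hv.mul_prod hu).bdd_mul (c := 1)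
      (f := fun p => Complex.exp (-Complex.I * (inner ℝ (X p.2) (Y p.1) : ℝ))) (by fun_prop)
      (.of_forall fun p => (norm_exp_neg_I_mul_ofReal _).le)).congr (.of_forall fun p => ?_)
    ring
  simp only [fourierPush, ← integral_mul_const]
  rw [integral_integral_swap hint]
  simp only [real_inner_comm, mul_right_comm]

theorem fourierPush_toSphere_one_eq_of_norm_eq {ξ η : E} (h : ‖ξ‖ = ‖η‖) :
    fourierPush (volume : Measure E).toSphere Subtype.val (fun _ => 1) ξ
      = fourierPush (volume : Measure E).toSphere Subtype.val (fun _ => 1) η := by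
  simpa [surfaceMeasure, charFun_map_eq_fourierPush measurable_subtype_coe]
    using charFun_surfaceMeasure_eq_of_norm_eq (ξ := -ξ) (η := -η) (by simpa using h)

theorem fourierPush_mul_fourierPush_one_zero {u : Metric.sphere (0 : E) 1 → ℂ}
    (hu : Integrable u (volume : Measure E).toSphere)
    (h : ∀ ξ η : E, ‖ξ‖ = ‖η‖ → fourierPush (volume : Measure E).toSphere Subtype.val u ξ
      = fourierPush (volume : Measure E).toSphere Subtype.val u η) (ξ : E) :
    fourierPush (volume : Measure E).toSphere Subtype.val u ξ
        * fourierPush (volume : Measure E).toSphere Subtype.val (fun _ => 1) 0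
      = fourierPush (volume : Measure E).toSphere Subtype.val (fun _ => 1) ξ
        * fourierPush (volume : Measure E).toSphere Subtype.val u 0 := by
  have hnorm (a : Metric.sphere (0 : E) 1) : ‖‖ξ‖ • (a : E)‖ = ‖ξ‖ := by simp [norm_smul]
  have hone (a : E) : fourierPush (volume : Measure E).toSphere (fun b => ‖ξ‖ • (b : E))
      (fun _ => 1) a = fourierPush (volume : Measure E).toSphere Subtype.val (fun _ => 1)
        (‖ξ‖ • a) := by
    simp only [fourierPush, real_inner_smul_left, real_inner_smul_right]
  have := integral_fourierPush_mul_comm (Q := (volume : Measure E).toSphere)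
    (Y := fun b => ‖ξ‖ • (b : E)) measurable_subtype_coe (by fun_prop) hu
    (integrable_const (1 : ℂ))
  simp only [hone, h _ _ (hnorm _), fourierPush_toSphere_one_eq_of_norm_eq (hnorm _),
    integral_const_mul] at this
  simpa [fourierPush] using this

theorem ae_eq_const_of_fourierPush_eq_of_norm_eq [Nontrivial E] {u : Metric.sphere (0 : E) 1 → ℂ}
    (hu : Integrable u (volume : Measure E).toSphere)
    (h : ∀ ξ η : E, ‖ξ‖ = ‖η‖ → fourierPush (volume : Measure E).toSphere Subtype.val u ξ
      = fourierPush (volume : Measure E).toSphere Subtype.val u η) :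
    ∃ c, u =ᵐ[(volume : Measure E).toSphere] fun _ => c := by
  have : NeZero (volume : Measure E).toSphere := ⟨Measure.toSphere_ne_zero _⟩
  set m := fourierPush (volume : Measure E).toSphere Subtype.val (fun _ => 1) 0 with hm
  have hm0 : m ≠ 0 := by
    simpa [hm, fourierPush] using
      (measureReal_univ_pos (μ := (volume : Measure E).toSphere)).ne'
  refine ⟨fourierPush (volume : Measure E).toSphere Subtype.val u 0 / m * 1,
    ae_eq_of_fourierPush_eq hu (integrable_const _)
      (MeasurableEmbedding.subtype_coe Metric.isClosed_sphere.measurableSet) fun ξ => ?_⟩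
  rw [fourierPush_const_mul, div_mul_eq_mul_div, eq_div_iff hm0,
    fourierPush_mul_fourierPush_one_zero hu h, mul_comm]

end Rotation

section Laplace

variable {d : ℕ}

/-- The exponential `x ↦ e^{z·x}` with complex frequency `z`. -/
noncomputable def expDot (z : Fin d → ℂ) (x : EuclideanSpace ℝ (Fin d)) : ℂ :=
  Complex.exp (∑ i, z i * (x i : ℂ))

theorem expDot_zero (x : EuclideanSpace ℝ (Fin d)) : expDot 0 x = 1 := by
  simp [expDot]

theorem expDot_add (z w : Fin d → ℂ) (x : EuclideanSpace ℝ (Fin d)) :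
    expDot (z + w) x = expDot z x * expDot w x := by
  simp only [expDot, Pi.add_apply, add_mul, Finset.sum_add_distrib, Complex.exp_add]

theorem expDot_sum {ι : Type*} [Fintype ι] (z : Fin d → ℂ) (x : ι → EuclideanSpace ℝ (Fin d)) :
    expDot z (∑ j, x j) = ∏ j, expDot z (x j) := by
  simp only [expDot, ← Complex.exp_sum]
  rw [Finset.sum_comm]
  simp [Finset.mul_sum]

@[fun_prop]
theorem contDiff_expDot (z : Fin d → ℂ) : ContDiff ℝ 1 (expDot z) := by
  have (i : Fin d) : ContDiff ℝ 1 fun x : EuclideanSpace ℝ (Fin d) => (x i : ℂ) :=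
    Complex.ofRealCLM.contDiff.comp (by fun_prop)
  unfold expDot
  fun_prop

@[fun_prop]
theorem continuous_expDot (z : Fin d → ℂ) : Continuous (expDot z) :=
  (contDiff_expDot z).continuous

theorem fderiv_expDot (z : Fin d → ℂ) (x v : EuclideanSpace ℝ (Fin d)) :
    fderiv ℝ (expDot z) x v = (∑ i, z i * (v i : ℂ)) * expDot z x := by
  set L : EuclideanSpace ℝ (Fin d) →L[ℝ] ℂ :=
    ∑ i, z i • Complex.ofRealCLM.comp (EuclideanSpace.proj i) with hL
  have hexp : expDot z = fun x => Complex.exp (L x) := by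
    ext x
    simp [expDot, hL]
  rw [hexp, L.hasFDerivAt.cexp.fderiv]
  simp [hL, mul_comm]

/-- The purely imaginary frequency `-iξ`, which turns `expDot` into the kernel of `fourierPush`. -/
noncomputable def imagVec (ξ : EuclideanSpace ℝ (Fin d)) : Fin d → ℂ :=
  fun i => -Complex.I * ξ i

theorem expDot_imagVec (ξ x : EuclideanSpace ℝ (Fin d)) :
    expDot (imagVec ξ) x = Complex.exp (-Complex.I * (inner ℝ x ξ : ℝ)) := by
  simp [expDot, imagVec, PiLp.inner_apply, Finset.mul_sum, mul_assoc]

theorem fourierPush_surf (u : Sph d → ℂ) (ξ : EuclideanSpace ℝ (Fin d)) :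
    fourierPush (surf d) Subtype.val u ξ = ∫ a, u a * expDot (imagVec ξ) a ∂(surf d) := by
  simp only [fourierPush, expDot_imagVec, mul_comm (u _)]

/-- The gradient at `z` of the Laplace transform `z ↦ ∫ u(ζ) e^{z·ζ} dσ(ζ)`. -/
noncomputable def laplaceGradient (u : Sph d → ℂ) (z : Fin d → ℂ) : Fin d → ℂ :=
  fun i => ∫ a, u a * ((a.1 i : ℂ) * expDot z a) ∂(surf d)

theorem laplaceGradient_mul_expDot (u : Sph d → ℂ) (z w : Fin d → ℂ) :
    laplaceGradient (fun a => u a * expDot w a) z = laplaceGradient u (z + w) := by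
  ext i
  simp only [laplaceGradient, expDot_add]
  congr with a
  ring

theorem laplaceGradient_congr {u v : Sph d → ℂ} (h : u =ᵐ[surf d] v) :
    laplaceGradient u = laplaceGradient v := by
  ext z i
  exact integral_congr_ae (h.mono fun a ha => by simp only [ha])

theorem laplaceGradient_const_mul (c : ℂ) (u : Sph d → ℂ) (z : Fin d → ℂ) :
    laplaceGradient (fun a => c * u a) z = c • laplaceGradient u z := by
  ext i
  simp only [laplaceGradient, mul_assoc, integral_const_mul, Pi.smul_apply, smul_eq_mul]

theorem fourierPush_surf_coord_mul_expDot (z : Fin d → ℂ) (i : Fin d)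
    (ξ : EuclideanSpace ℝ (Fin d)) :
    fourierPush (surf d) Subtype.val (fun a => (a.1 i : ℂ) * expDot z a) ξ
      = laplaceGradient (fun _ => 1) (z + imagVec ξ) i := by
  simp only [fourierPush_surf, laplaceGradient, expDot_add, one_mul, mul_assoc]

theorem dotProduct_laplaceGradient {u : Sph d → ℂ} (hu : Integrable u (surf d))
    (α z : Fin d → ℂ) : α ⬝ᵥ laplaceGradient u z
      = ∫ a, u a * ((∑ i, α i * (a.1 i : ℂ)) * expDot z a) ∂(surf d) := by
  simp only [dotProduct, laplaceGradient, ← integral_const_mul]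
  rw [← integral_finsetSum]
  · congr with a
    rw [Finset.sum_mul, Finset.mul_sum]
    exact Finset.sum_congr rfl fun i _ => by ring
  · exact fun i _ => (integrable_smul_of_compactSpace hu (by fun_prop)).const_mul _

/-- The infinitesimal rotation of the plane spanned by the `j`-th and `l`-th coordinate axes. -/
noncomputable def planeRotation (j l : Fin d) :
    EuclideanSpace ℝ (Fin d) →L[ℝ] EuclideanSpace ℝ (Fin d) :=
  InnerProductSpace.rankOne ℝ (EuclideanSpace.single l 1) (EuclideanSpace.single j 1)
    - InnerProductSpace.rankOne ℝ (EuclideanSpace.single j 1) (EuclideanSpace.single l 1)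

theorem planeRotation_mem_skewAdjoint (j l : Fin d) :
    planeRotation j l ∈ skewAdjoint _ := by
  simp [planeRotation, skewAdjoint.mem_iff, ContinuousLinearMap.star_eq_adjoint,
    InnerProductSpace.adjoint_rankOne]

theorem laplaceGradient_one_mul_comm (z : Fin d → ℂ) (j l : Fin d) :
    z l * laplaceGradient (fun _ => 1) z j = z j * laplaceGradient (fun _ => 1) z l := by
  have h := integral_toSphere_fderiv_skewAdjoint (planeRotation_mem_skewAdjoint j l)
    (contDiff_expDot z)
  simp only [fderiv_expDot] at h
  have hα : (z l • Pi.single j 1 - z j • Pi.single l 1) ⬝ᵥ laplaceGradient (fun _ => 1) z = 0 := by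
    rw [dotProduct_laplaceGradient (integrable_const 1), ← h]
    congr with a
    simp [planeRotation, Pi.single_apply, sub_mul, mul_sub, Finset.sum_sub_distrib,
      EuclideanSpace.inner_single_left, apply_ite Complex.ofReal]
  simpa [sub_dotProduct, sub_eq_zero] using hα

theorem laplaceGradient_one_zero : laplaceGradient (fun _ => 1) (0 : Fin d → ℂ) = 0 := by
  ext i
  have h := integral_toSphere_comp_linearIsometryEquiv (LinearIsometryEquiv.neg ℝ)
    (φ := fun x : EuclideanSpace ℝ (Fin d) => (x i : ℂ)) (by fun_prop)
  simpa [laplaceGradient, expDot_zero, integral_neg, neg_eq_self] using h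

theorem exists_laplaceGradient_one_eq_smul (z : Fin d → ℂ) :
    ∃ c : ℂ, laplaceGradient (fun _ => 1) z = c • z := by
  rcases eq_or_ne z 0 with rfl | hz
  · exact ⟨0, by rw [laplaceGradient_one_zero, smul_zero]⟩
  · obtain ⟨i, hi⟩ := Function.ne_iff.1 hz
    refine ⟨laplaceGradient (fun _ => 1) z i / z i, funext fun j => ?_⟩
    rw [Pi.smul_apply, smul_eq_mul, div_mul_eq_mul_div, eq_div_iff hi, mul_comm,
      laplaceGradient_one_mul_comm, mul_comm]

end Laplace

section Extraction

variable {d : ℕ}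

theorem fderiv_fourierPush_surf_apply {u : Sph d → ℂ} (hu : Integrable u (surf d))
    (ξ v : EuclideanSpace ℝ (Fin d)) : fderiv ℝ (fourierPush (surf d) Subtype.val u) ξ v
      = -Complex.I * ((fun i => (v i : ℂ)) ⬝ᵥ laplaceGradient u (imagVec ξ)) := by
  rw [fderiv_fourierPush_toSphere_apply hu, dotProduct_laplaceGradient hu]
  simp [expDot_imagVec, PiLp.inner_apply]

theorem ae_eq_const_of_mul_laplaceGradient_comm (hd : 2 ≤ d) {u : Sph d → ℂ}
    (hu : Integrable u (surf d))
    (h : ∀ z j l, z l * laplaceGradient u z j = z j * laplaceGradient u z l) :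
    ∃ c, u =ᵐ[surf d] fun _ => c := by
  have hfin : 2 ≤ Module.finrank ℝ (EuclideanSpace ℝ (Fin d)) := by
    rwa [finrank_euclideanSpace_fin]
  have : Nontrivial (EuclideanSpace ℝ (Fin d)) :=
    Module.nontrivial_of_finrank_pos (R := ℝ) (two_pos.trans_le hfin)
  refine ae_eq_const_of_fourierPush_eq_of_norm_eq hu fun ξ η hξη =>
    eq_of_norm_eq_of_fderiv_eq_zero_of_inner_eq_zero hfin
      (fun ξ => (hasFDerivAt_fourierPush_toSphere hu ξ).differentiableAt) (fun ξ hξ v hv => ?_) hξη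
  obtain ⟨i, hi⟩ : ∃ i, ξ i ≠ 0 := by
    by_contra! hzero
    exact hξ (PiLp.ext hzero)
  have hv : ∑ l, (ξ l : ℂ) * v l = 0 := by
    simpa [PiLp.inner_apply, mul_comm] using congrArg Complex.ofReal hv
  have hI (l : Fin d) : (ξ i : ℂ) * laplaceGradient u (imagVec ξ) l
      = ξ l * laplaceGradient u (imagVec ξ) i := by
    simpa [imagVec, mul_assoc] using h (imagVec ξ) l i
  have hdot : (ξ i : ℂ) * ((fun l => (v l : ℂ)) ⬝ᵥ laplaceGradient u (imagVec ξ)) = 0 := by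
    rw [← zero_mul (laplaceGradient u (imagVec ξ) i), ← hv, dotProduct, Finset.mul_sum,
      Finset.sum_mul]
    exact Finset.sum_congr rfl fun l _ => by linear_combination (v l : ℂ) * hI l
  rw [fderiv_fourierPush_surf_apply hu,
    (mul_eq_zero.1 hdot).resolve_left (Complex.ofReal_ne_zero.2 hi), mul_zero]

theorem ae_eq_const_mul_expDot_of_sub_mul_laplaceGradient_comm (hd : 2 ≤ d) {u : Sph d → ℂ}
    (hu : Integrable u (surf d)) {p : Fin d → ℂ}
    (h : ∀ z j l, (z l - p l) * laplaceGradient u z j = (z j - p j) * laplaceGradient u z l) :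
    ∃ c, ∀ᵐ a ∂(surf d), u a = c * expDot (-p) a := by
  obtain ⟨c, hc⟩ := ae_eq_const_of_mul_laplaceGradient_comm hd
    (u := fun a => u a * expDot p a) (integrable_smul_of_compactSpace hu (by fun_prop))
    fun z j l => by simpa [laplaceGradient_mul_expDot] using h (z + p) j l
  refine ⟨c, ?_⟩
  filter_upwards [hc] with a ha
  rw [← ha, mul_assoc, ← expDot_add, add_neg_cancel, expDot_zero, mul_one]

theorem prod_extend_apply {ι κ α M : Type*} [Fintype ι] [DecidableEq ι] [Fintype κ]
    [CommMonoid M] (e : κ ↪ ι) (g : ι → α → M) (ψ : κ → α) (φ : ι → α) :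
    ∏ j, g j (Function.extend e ψ φ j)
      = (∏ r, g (e r) (ψ r)) * ∏ j ∈ (Finset.univ.map e)ᶜ, g j (φ j) := by
  rw [← Finset.prod_mul_prod_compl (Finset.univ.map e), Finset.prod_map]
  congr 1
  · simp only [e.injective.extend_apply]
  · refine Finset.prod_congr rfl fun j hj => ?_
    rw [Function.extend_apply' _ _ _ (by simpa using hj)]

theorem IsFunctionOfSum.sum_prod_integral_eq_zero {ι S : Type*} [Fintype ι] [Fintype S]
    {f : ι → Sph d → ℂ} (hG : IsFunctionOfSum f) (hf : ∀ j, Integrable (f j) (surf d))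
    (c : S → ℂ) {ψ : S → ι → Sph d → ℂ} (hψ : ∀ s j, Continuous (ψ s j))
    (h : ∀ ξ, ∑ s, c s * ∏ j, fourierPush (surf d) Subtype.val (ψ s j) ξ = 0) :
    ∑ s, c s * ∏ j, ∫ a, f j a * ψ s j a ∂(surf d) = 0 := by
  have hint (s : S) : Integrable (fun ζ : ι → Sph d => c s * ∏ j, ψ s j (ζ j))
      (Measure.pi fun _ => surf d) := (Integrable.fintype_prod fun j => by
    simpa using integrable_smul_of_compactSpace (integrable_const (1 : ℂ)) (hψ s j)).const_mul _
  have hfint (s : S) : Integrable (fun ζ : ι → Sph d => c s * ∏ j, (f j (ζ j) * ψ s j (ζ j)))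
      (Measure.pi fun _ => surf d) := (Integrable.fintype_prod fun j =>
    integrable_smul_of_compactSpace (hf j) (hψ s j)).const_mul _
  have hpush (ξ : EuclideanSpace ℝ (Fin d)) : fourierPush (Measure.pi fun _ : ι => surf d)
      (fun ζ => ∑ j, (ζ j : EuclideanSpace ℝ (Fin d)))
      (fun ζ => ∑ s, c s * ∏ j, ψ s j (ζ j)) ξ = 0 := by
    rw [fourierPush_finsetSum _ (fun s _ => hint s) (by fun_prop), ← h ξ]
    refine Finset.sum_congr rfl fun s _ => ?_
    rw [fourierPush_const_mul, fourierPush_pi_sum]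
  have hmul (ζ : ι → Sph d) : (∏ j, f j (ζ j)) * ∑ s, c s * ∏ j, ψ s j (ζ j)
      = ∑ s, c s * ∏ j, (f j (ζ j) * ψ s j (ζ j)) := by
    simp only [Finset.mul_sum, Finset.prod_mul_distrib, mul_left_comm]
  have hzero := integral_mul_eq_zero_of_fourierPush (integrable_finsetSum _ fun s _ => hint s)
    (by fun_prop) hpush hG (by simpa only [hmul] using integrable_finsetSum _ fun s _ => hfint s)
  simp only [hmul] at hzero
  rw [integral_finsetSum _ fun s _ => hfint s] at hzero
  refine (Finset.sum_congr rfl fun s _ => ?_).trans hzero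
  rw [integral_const_mul, integral_fintype_prod_eq_prod (f := fun j a => f j a * ψ s j a)]

theorem exists_fourierPush_surf_ne_zero {u : Sph d → ℂ} (hu : Integrable u (surf d))
    (hu0 : ¬ u =ᵐ[surf d] 0) : ∃ ξ, fourierPush (surf d) Subtype.val u ξ ≠ 0 := by
  by_contra! h
  exact hu0 (ae_eq_zero_of_fourierPush hu
    (MeasurableEmbedding.subtype_coe Metric.isClosed_sphere.measurableSet) h)

theorem IsFunctionOfSum.sum_prod_integral_embedding_eq_zero {ι κ S : Type*} [Fintype ι]
    [Fintype κ] [Fintype S] {f : ι → Sph d → ℂ} (hG : IsFunctionOfSum f)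
    (hf : ∀ j, Integrable (f j) (surf d)) (hf0 : ∀ j, ¬ f j =ᵐ[surf d] 0) (e : κ ↪ ι)
    (c : S → ℂ) {ψ : S → κ → Sph d → ℂ} (hψ : ∀ s r, Continuous (ψ s r))
    (h : ∀ ξ, ∑ s, c s * ∏ r, fourierPush (surf d) Subtype.val (ψ s r) ξ = 0) :
    ∑ s, c s * ∏ r, ∫ a, f (e r) a * ψ s r a ∂(surf d) = 0 := by
  classical
  choose w hw using fun j => exists_fourierPush_surf_ne_zero (hf j) (hf0 j)
  simp only [fourierPush_surf] at hw
  set φ : ι → Sph d → ℂ := fun j a => expDot (imagVec (w j)) a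
  have hsum := hG.sum_prod_integral_eq_zero hf c (ψ := fun s => Function.extend e (ψ s) φ)
    (fun s j => ?_) fun ξ => ?_
  · simp only [prod_extend_apply e fun j (g : Sph d → ℂ) => ∫ a, f j a * g a ∂(surf d), ← mul_assoc,
      ← Finset.sum_mul] at hsum
    exact (mul_eq_zero.1 hsum).resolve_right (Finset.prod_ne_zero_iff.2 fun j _ => hw j)
  · by_cases hj : ∃ r, e r = j
    · obtain ⟨r, rfl⟩ := hj
      simpa only [e.injective.extend_apply] using hψ s r
    · rw [Function.extend_apply' _ _ _ hj]
      fun_prop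
  · simp only [prod_extend_apply e fun _ g => fourierPush (surf d) Subtype.val g ξ, ← mul_assoc,
      ← Finset.sum_mul, h ξ, zero_mul]

theorem IsFunctionOfSum.exists_ae_eq_const_mul {ι : Type*} [Fintype ι] {f : ι → Sph d → ℂ}
    (hG : IsFunctionOfSum f) (hf : ∀ j, Integrable (f j) (surf d))
    (hf0 : ∀ j, ¬ f j =ᵐ[surf d] 0) (i j : ι) :
    ∃ c : ℂ, c ≠ 0 ∧ f j =ᵐ[surf d] fun a => c * f i a := by
  rcases eq_or_ne i j with rfl | hij
  · exact ⟨1, one_ne_zero, by simp⟩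
  have hcont (ξ : EuclideanSpace ℝ (Fin d)) :
      Continuous fun a : Sph d => expDot (imagVec ξ) a := by
    fun_prop
  have hswap (ξ η : EuclideanSpace ℝ (Fin d)) :
      fourierPush (surf d) Subtype.val (f i) ξ * fourierPush (surf d) Subtype.val (f j) η
        = fourierPush (surf d) Subtype.val (f i) η * fourierPush (surf d) Subtype.val (f j) ξ := by
    have h := hG.sum_prod_integral_embedding_eq_zero hf hf0 (S := Fin 2)
      ⟨![i, j], List.nodup_ofFn.1 (by simpa)⟩ ![1, -1]
      (ψ := ![![fun a => expDot (imagVec ξ) a, fun a => expDot (imagVec η) a],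
        ![fun a => expDot (imagVec η) a, fun a => expDot (imagVec ξ) a]])
      (Fin.forall_fin_two.2 ⟨Fin.forall_fin_two.2 ⟨hcont ξ, hcont η⟩,
        Fin.forall_fin_two.2 ⟨hcont η, hcont ξ⟩⟩)
      (fun ξ => by simp [mul_comm])
    simpa [fourierPush_surf, ← sub_eq_add_neg, sub_eq_zero] using h
  obtain ⟨w, hw⟩ := exists_fourierPush_surf_ne_zero (hf i) (hf0 i)
  set c := fourierPush (surf d) Subtype.val (f j) w / fourierPush (surf d) Subtype.val (f i) w
  have hae : f j =ᵐ[surf d] fun a => c * f i a :=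
    ae_eq_of_fourierPush_eq (hf j) ((hf i).const_mul c)
      (MeasurableEmbedding.subtype_coe Metric.isClosed_sphere.measurableSet) fun ξ => by
        rw [fourierPush_const_mul, div_mul_eq_mul_div, eq_div_iff hw]
        linear_combination hswap w ξ
  refine ⟨c, fun hc => hf0 j (hae.trans (.of_forall fun a => ?_)), hae⟩
  simp [hc]

end Extraction

section Transfer

variable {d : ℕ}

theorem multilinearMap_apply_eq_sum {R κ n : Type*} [CommSemiring R] [Fintype κ] [DecidableEq κ]
    [Fintype n] [DecidableEq n] (B : MultilinearMap R (fun _ : κ => n → R) R) (x : κ → n → R) :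
    B x = ∑ s : κ → n, B (fun r => Pi.single (s r) 1) * ∏ r, x r (s r) := by
  conv_lhs => rw [funext fun r => pi_eq_sum_univ' (x r)]
  rw [B.map_sum]
  simp only [B.map_smul_univ, smul_eq_mul, mul_comm]

variable {ι κ : Type*} [Fintype ι] {f : ι → Sph d → ℂ}

theorem IsFunctionOfSum.exists_laplaceGradient_eq_smul (hG : IsFunctionOfSum f)
    (hf : ∀ j, Integrable (f j) (surf d)) (hf0 : ∀ j, ¬ f j =ᵐ[surf d] 0) (i j : ι) :
    ∃ c : ℂ, ∀ z, laplaceGradient (f i) z = c • laplaceGradient (f j) z := by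
  obtain ⟨c, -, hc⟩ := hG.exists_ae_eq_const_mul hf hf0 j i
  exact ⟨c, fun z => by rw [laplaceGradient_congr hc, laplaceGradient_const_mul]⟩

/- The symmetry of the sphere transfers every multilinear relation satisfied by the vectors
`z r + ζ`, which are the gradients for `f = 1` up to scalars, to the gradients of the factors. -/
theorem IsFunctionOfSum.map_laplaceGradient_eq_zero (hG : IsFunctionOfSum f)
    (hf : ∀ j, Integrable (f j) (surf d)) (hf0 : ∀ j, ¬ f j =ᵐ[surf d] 0) (e : κ ↪ ι) (i : ι)
    {B : MultilinearMap ℂ (fun _ : κ => Fin d → ℂ) ℂ} {z : κ → Fin d → ℂ}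
    (h : ∀ ζ, B (fun r => z r + ζ) = 0) : B (fun r => laplaceGradient (f i) (z r)) = 0 := by
  classical
  have := Fintype.ofInjective e e.injective
  choose a ha using exists_laplaceGradient_one_eq_smul (d := d)
  have hone (ξ : EuclideanSpace ℝ (Fin d)) :
      B (fun r => laplaceGradient (fun _ => 1) (z r + imagVec ξ)) = 0 := by
    simp only [ha, B.map_smul_univ, h, smul_zero]
  have hmixed : B (fun r => laplaceGradient (f (e r)) (z r)) = 0 := by
    rw [multilinearMap_apply_eq_sum]
    refine hG.sum_prod_integral_embedding_eq_zero hf hf0 e (S := κ → Fin d)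
      (fun s => B fun r => Pi.single (s r) 1)
      (ψ := fun s r b => (b.1 (s r) : ℂ) * expDot (z r) b) (fun s r => by fun_prop) fun ξ => ?_
    simp only [fourierPush_surf_coord_mul_expDot]
    rw [← multilinearMap_apply_eq_sum, hone]
  choose b hb using fun r => hG.exists_laplaceGradient_eq_smul hf hf0 i (e r)
  rw [funext fun r => hb r (z r), B.map_smul_univ, hmixed, smul_zero]

end Transfer

section Nondegenerate

variable {d : ℕ}

theorem ae_surf_inner_ne_zero (hd : 2 ≤ d) {x : EuclideanSpace ℝ (Fin d)} (hx : x ≠ 0) :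
    ∀ᵐ a : Sph d ∂(surf d), inner ℝ x (a : EuclideanSpace ℝ (Fin d)) ≠ 0 := by
  have hae := measure_eq_zero_iff_ae_notMem.1 (surfaceMeasure_inner_mem_eq_zero
    (hd.trans_eq finrank_euclideanSpace_fin.symm) (norm_smul_inv_norm (𝕜 := ℝ) hx)
    (measure_singleton (0 : ℝ)))
  filter_upwards [ae_of_ae_map measurable_subtype_coe.aemeasurable hae] with a ha h0
  simp [real_inner_smul_left, h0] at ha

theorem ae_surf_sum_mul_ne_zero (hd : 2 ≤ d) {α : Fin d → ℂ} (hα : α ≠ 0) :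
    ∀ᵐ a ∂(surf d), ∑ i, α i * (a.1 i : ℂ) ≠ 0 := by
  have hparts : (WithLp.toLp 2 fun i => (α i).re : EuclideanSpace ℝ (Fin d)) ≠ 0 ∨
      (WithLp.toLp 2 fun i => (α i).im : EuclideanSpace ℝ (Fin d)) ≠ 0 := by
    by_contra! h
    exact hα (funext fun i => Complex.ext congr($(h.1) i) congr($(h.2) i))
  rcases hparts with h | h
  · filter_upwards [ae_surf_inner_ne_zero hd h] with a ha hsum
    exact ha (by simpa [PiLp.inner_apply, mul_comm] using congrArg Complex.re hsum)
  · filter_upwards [ae_surf_inner_ne_zero hd h] with a ha hsum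
    exact ha (by simpa [PiLp.inner_apply, mul_comm] using congrArg Complex.im hsum)

theorem exists_laplaceGradient_notMem (hd : 2 ≤ d) {u : Sph d → ℂ} (hu : Integrable u (surf d))
    (hu0 : ¬ u =ᵐ[surf d] 0) {V : Submodule ℂ (Fin d → ℂ)} (hV : V ≠ ⊤) :
    ∃ z, laplaceGradient u z ∉ V := by
  obtain ⟨φ, hφ, hVφ⟩ := V.exists_le_ker_of_lt_top hV.lt_top
  obtain ⟨α, rfl⟩ := (dotProductEquiv ℂ (Fin d)).surjective φ
  have hα : α ≠ 0 := by
    rintro rfl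
    exact hφ (map_zero _)
  by_contra! hmem
  have hzero := ae_eq_zero_of_fourierPush (u := fun a => u a * ∑ i, α i * (a.1 i : ℂ))
    (integrable_smul_of_compactSpace hu (by fun_prop))
    (MeasurableEmbedding.subtype_coe Metric.isClosed_sphere.measurableSet) fun ξ => by
      rw [fourierPush_surf]
      simp only [mul_assoc]
      rw [← dotProduct_laplaceGradient hu]
      exact hVφ (hmem _)
  refine hu0 ?_
  filter_upwards [hzero, ae_surf_sum_mul_ne_zero hd hα] with a ha hne
  exact (mul_eq_zero.1 ha).resolve_right hne

end Nondegenerate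

section Lines

variable {K V ι : Type*} [Field K] [AddCommGroup V] [Module K V] {x m : ι → V}

theorem exists_alternatingMap_apply_ne_zero {n : ℕ} {v : Fin n → V} (hv : LinearIndependent K v) :
    ∃ D : V [⋀^Fin n]→ₗ[K] K, D v ≠ 0 := by
  obtain ⟨g, hg⟩ := (Fintype.linearCombination K v).exists_leftInverse_of_injective
    (LinearMap.ker_eq_bot.2 hv.fintypeLinearCombination_injective)
  have hgv : (fun i => g (v i)) = (1 : Matrix (Fin n) (Fin n) K) := by
    ext i j
    simpa [Fintype.linearCombination_apply_single, Matrix.one_eq_pi_single] using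
      congr($hg (Pi.single i 1) j)
  refine ⟨Matrix.detRowAlternating.compLinearMap g, ?_⟩
  rw [AlternatingMap.compLinearMap_apply]
  change Matrix.det (fun i => g (v i)) ≠ 0
  simp [hgv]

theorem linearIndependent_pair_of_ne {κ : Type*} {b : κ → V} (hb : LinearIndependent K b)
    {i j : κ} (hij : i ≠ j) : LinearIndependent K ![b i, b j] := by
  have h := hb.comp ![i, j] (List.nodup_ofFn.1 (by simpa))
  rwa [← FinVec.map_eq] at h

theorem exists_linearIndependent_cons_pair {b : Fin 3 → V} (hb : LinearIndependent K b) {y : V}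
    (hy : y ≠ 0) : ∃ i j, LinearIndependent K ![y, b i, b j] := by
  by_contra! h
  have hspan (i j : Fin 3) (hij : i ≠ j) : ∃ α β : K, α • b i + β • b j = y := by
    rw [← Submodule.mem_span_pair]
    by_contra hmem
    exact h i j ((linearIndependent_pair_of_ne hb hij).finCons
      (by simpa [Set.pair_comm] using hmem))
  obtain ⟨α₀, α₁, hα⟩ := hspan 0 1 (by decide)
  obtain ⟨β₀, β₂, hβ⟩ := hspan 0 2 (by decide)
  obtain ⟨γ₁, γ₂, hγ⟩ := hspan 1 2 (by decide)
  have hα₁ : α₁ = 0 := Fintype.linearIndependent_iff.1 hb ![α₀ - β₀, α₁, -β₂] (by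
    simp only [Fin.sum_univ_three, Matrix.cons_val]
    linear_combination (norm := module) hα - hβ) 1
  have hα₀ : α₀ = 0 := Fintype.linearIndependent_iff.1 hb ![α₀, α₁ - γ₁, -γ₂] (by
    simp only [Fin.sum_univ_three, Matrix.cons_val]
    linear_combination (norm := module) hα - hγ) 0
  exact hy (by rw [← hα, hα₀, hα₁, zero_smul, zero_smul, add_zero])

theorem sub_mem_span_singleton_of_coplanar
    (hcop : ∀ s t, LinearIndependent K ![m s, m t] → x s - x t ∈ Submodule.span K {m s, m t})
    {s t v : ι} (h : LinearIndependent K ![m v, m s, m t]) {p : V}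
    (hs : x s - p ∈ Submodule.span K {m s}) (ht : x t - p ∈ Submodule.span K {m t}) :
    x v - p ∈ Submodule.span K {m v} := by
  obtain ⟨α, β, hvs⟩ := Submodule.mem_span_pair.1
    (hcop v s (linearIndependent_pair_of_ne h (i := 0) (j := 1) (by decide)))
  obtain ⟨α', γ, hvt⟩ := Submodule.mem_span_pair.1
    (hcop v t (linearIndependent_pair_of_ne h (i := 0) (j := 2) (by decide)))
  obtain ⟨β', hs⟩ := Submodule.mem_span_singleton.1 hs
  obtain ⟨γ', ht⟩ := Submodule.mem_span_singleton.1 ht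
  have hβ : β + β' = 0 :=
    Fintype.linearIndependent_iff.1 h ![α - α', β + β', -(γ + γ')] (by
      simp only [Fin.sum_univ_three, Matrix.cons_val]
      linear_combination (norm := module) hvs - hvt + hs - ht) 1
  refine Submodule.mem_span_singleton.2 ⟨α, ?_⟩
  linear_combination (norm := module) hvs + hs - hβ • m s

/- Geometrically: pairwise coplanar lines `x s + K m s`, not all in one plane, are concurrent. -/
theorem exists_forall_sub_mem_span_singleton
    (hcop : ∀ s t, LinearIndependent K ![m s, m t] → x s - x t ∈ Submodule.span K {m s, m t})
    {τ : Fin 3 → ι} (hτ : LinearIndependent K fun i => m (τ i)) :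
    ∃ p, ∀ v, m v ≠ 0 → x v - p ∈ Submodule.span K {m v} := by
  obtain ⟨α, β, h⟩ := Submodule.mem_span_pair.1
    (hcop _ _ (linearIndependent_pair_of_ne hτ (i := 0) (j := 1) (by decide)))
  set p := x (τ 0) - α • m (τ 0) with hp
  have hp₀ : x (τ 0) - p ∈ Submodule.span K {m (τ 0)} :=
    Submodule.mem_span_singleton.2 ⟨α, by rw [hp]; module⟩
  have hp₁ : x (τ 1) - p ∈ Submodule.span K {m (τ 1)} :=
    Submodule.mem_span_singleton.2 ⟨-β, by
      rw [hp]
      linear_combination (norm := module) - h⟩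
  have hrot : LinearIndependent K ![m (τ 2), m (τ 0), m (τ 1)] := by
    have hcomp := hτ.comp ![2, 0, 1] (by decide)
    rwa [← FinVec.map_eq] at hcomp
  have hp₂ := sub_mem_span_singleton_of_coplanar hcop hrot hp₀ hp₁
  have hpτ : ∀ i, x (τ i) - p ∈ Submodule.span K {m (τ i)} :=
    Fin.forall_fin_succ.2 ⟨hp₀, Fin.forall_fin_two.2 ⟨hp₁, hp₂⟩⟩
  refine ⟨p, fun v hv => ?_⟩
  obtain ⟨i, j, hij⟩ := exists_linearIndependent_cons_pair hτ hv
  exact sub_mem_span_singleton_of_coplanar hcop hij (hpτ i) (hpτ j)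

end Lines

section Planar

variable {K ι : Type*} [Field K]

/-- Homogeneous coordinates, up to signs and order, of the line through `x` with direction `m`:
three lines of the plane are concurrent or parallel exactly when these vectors are linearly
dependent. -/
def lineCoords (x : Fin 2 → K) : (Fin 2 → K) →ₗ[K] Fin 3 → K :=
  LinearMap.pi
    ![LinearMap.proj 0, LinearMap.proj 1, x 1 • LinearMap.proj 0 - x 0 • LinearMap.proj 1]

theorem lineCoords_apply (x m : Fin 2 → K) :
    lineCoords x m = ![m 0, m 1, x 1 * m 0 - x 0 * m 1] := by
  ext i
  fin_cases i <;> rfl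

theorem det_lineCoords_add (z : Fin 3 → Fin 2 → K) (ζ : Fin 2 → K) :
    (Matrix.of fun r => lineCoords (z r) (z r + ζ)).det = 0 := by
  simp only [lineCoords_apply, Matrix.det_fin_three, Matrix.of_apply, Matrix.cons_val, Pi.add_apply]
  ring

theorem exists_forall_sub_mul_eq {x m : ι → Fin 2 → K} {s t : ι}
    (hst : LinearIndependent K ![m s, m t])
    (hdet : ∀ v : Fin 3 → ι, (Matrix.of fun r => lineCoords (x (v r)) (m (v r))).det = 0) :
    ∃ p : Fin 2 → K, ∀ v, (x v 1 - p 1) * m v 0 = (x v 0 - p 0) * m v 1 := by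
  have hΔ : m s 0 * m t 1 - m s 1 * m t 0 ≠ 0 := by
    have h : LinearIndependent K (Matrix.of ![m s, m t]).row := hst
    rw [Matrix.linearIndependent_rows_iff_isUnit, Matrix.isUnit_iff_isUnit_det] at h
    simpa [Matrix.det_fin_two] using h.ne_zero
  set Δ := m s 0 * m t 1 - m s 1 * m t 0 with hΔ_def
  set n : ι → K := fun v => x v 1 * m v 0 - x v 0 * m v 1 with hn
  refine ⟨![(n s * m t 0 - n t * m s 0) / Δ, (n s * m t 1 - n t * m s 1) / Δ], fun v => ?_⟩
  have h := hdet ![s, t, v]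
  simp only [lineCoords_apply, Matrix.det_fin_three, Matrix.of_apply, Matrix.cons_val] at h
  simp only [Matrix.cons_val, hn]
  field_simp
  rw [hΔ_def]
  linear_combination h

end Planar

section Concurrency

variable {d : ℕ} {ι : Type*} [Fintype ι] {f : ι → Sph d → ℂ}

theorem exists_linearIndependent_laplaceGradient (hd : 2 ≤ d) {u : Sph d → ℂ}
    (hu : Integrable u (surf d)) (hu0 : ¬ u =ᵐ[surf d] 0) :
    ∃ z : Fin d → Fin d → ℂ, LinearIndependent ℂ fun r => laplaceGradient u (z r) := by
  have hspan : Submodule.span ℂ (Set.range (laplaceGradient u)) = ⊤ := by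
    by_contra hV
    obtain ⟨z, hz⟩ := exists_laplaceGradient_notMem hd hu hu0 hV
    exact hz (Submodule.subset_span ⟨z, rfl⟩)
  have hbasis := Submodule.exists_fun_fin_finrank_span_eq ℂ (Set.range (laplaceGradient u))
  rw [hspan, finrank_top, Module.finrank_fin_fun] at hbasis
  obtain ⟨v, hv, -, hlin⟩ := hbasis
  choose z hz using hv
  exact ⟨z, by simpa only [hz] using hlin⟩

theorem IsFunctionOfSum.sub_mem_span_laplaceGradient (hG : IsFunctionOfSum f)
    (hf : ∀ j, Integrable (f j) (surf d)) (hf0 : ∀ j, ¬ f j =ᵐ[surf d] 0) (e : Fin 2 ↪ ι) (i : ι)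
    {z w : Fin d → ℂ}
    (hzw : LinearIndependent ℂ ![laplaceGradient (f i) z, laplaceGradient (f i) w]) :
    z - w ∈ Submodule.span ℂ {laplaceGradient (f i) z, laplaceGradient (f i) w} := by
  by_contra hmem
  have hlin : LinearIndependent ℂ ![z - w, laplaceGradient (f i) z, laplaceGradient (f i) w] :=
    hzw.finCons (by simpa [Set.pair_comm] using hmem)
  obtain ⟨D, hD⟩ := exists_alternatingMap_apply_ne_zero hlin
  have hB (ζ : Fin d → ℂ) : D.curryLeft (z - w) (fun r => ![z, w] r + ζ) = 0 := by
    rw [AlternatingMap.curryLeft_apply_apply]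
    refine D.map_linearDependent _ fun h => ?_
    have := Fintype.linearIndependent_iff.1 h ![1, -1, 1] (by
      simp only [Fin.sum_univ_three, Matrix.cons_val]
      module) 0
    simp at this
  have hD0 := hG.map_laplaceGradient_eq_zero hf hf0 e i
    (B := (D.curryLeft (z - w)).toMultilinearMap) hB
  have hpair : (fun r => laplaceGradient (f i) (![z, w] r)) =
      ![laplaceGradient (f i) z, laplaceGradient (f i) w] :=
    (FinVec.map_eq (laplaceGradient (f i)) ![z, w]).symm
  rw [hpair] at hD0
  exact hD hD0

theorem IsFunctionOfSum.det_lineCoords_laplaceGradient {f : ι → Sph 2 → ℂ}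
    (hG : IsFunctionOfSum f)
    (hf : ∀ j, Integrable (f j) (surf 2)) (hf0 : ∀ j, ¬ f j =ᵐ[surf 2] 0) (e : Fin 3 ↪ ι) (i : ι)
    (z : Fin 3 → Fin 2 → ℂ) :
    (Matrix.of fun r => lineCoords (z r) (laplaceGradient (f i) (z r))).det = 0 := by
  have h := hG.map_laplaceGradient_eq_zero hf hf0 e i (z := z)
    (B := Matrix.detRowAlternating.toMultilinearMap.compLinearMap fun r => lineCoords (z r))
    (fun ζ => by
      rw [MultilinearMap.compLinearMap_apply]
      exact det_lineCoords_add z ζ)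
  rwa [MultilinearMap.compLinearMap_apply] at h

theorem IsFunctionOfSum.exists_laplaceGradient_concurrent {k : ℕ} {f : Fin k → Sph d → ℂ}
    (hG : IsFunctionOfSum f) (hd : 2 ≤ d) (hk : 2 ≤ k) (hdk : (d, k) ≠ (2, 2))
    (hf : ∀ j, Integrable (f j) (surf d)) (hf0 : ∀ j, ¬ f j =ᵐ[surf d] 0) (i : Fin k) :
    ∃ p : Fin d → ℂ, ∀ z j l,
      (z l - p l) * laplaceGradient (f i) z j = (z j - p j) * laplaceGradient (f i) z l := by
  obtain ⟨τ, hτ⟩ := exists_linearIndependent_laplaceGradient hd (hf i) (hf0 i)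
  obtain hd3 | rfl := hd.lt_or_eq
  · obtain ⟨p, hp⟩ := exists_forall_sub_mem_span_singleton (x := id)
      (fun z w => hG.sub_mem_span_laplaceGradient hf hf0 (Fin.castLEEmb hk) i)
      (hτ.comp (Fin.castLE hd3) (Fin.castLE_injective hd3))
    refine ⟨p, fun z j l => ?_⟩
    by_cases hz : laplaceGradient (f i) z = 0
    · simp [hz]
    · obtain ⟨t, ht⟩ := Submodule.mem_span_singleton.1 (hp z hz)
      have hcoord (r : Fin d) : t * laplaceGradient (f i) z r = z r - p r := congrFun ht r
      rw [← hcoord, ← hcoord]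
      ring
  · have hk3 : 3 ≤ k := hk.lt_of_ne fun h => hdk (by rw [h])
    obtain ⟨p, hp⟩ := exists_forall_sub_mul_eq (x := id)
      (linearIndependent_pair_of_ne hτ zero_ne_one)
      (fun v => hG.det_lineCoords_laplaceGradient hf hf0 (Fin.castLEEmb hk3) i v)
    refine ⟨p, fun z => Fin.forall_fin_two.2 ⟨Fin.forall_fin_two.2 ⟨rfl, hp z⟩,
      Fin.forall_fin_two.2 ⟨(hp z).symm, rfl⟩⟩⟩

end Concurrency

section Exponentials

variable {d : ℕ}

theorem exists_ae_eq_const_mul_expDot {k : ℕ} {f : Fin k → Sph d → ℂ} (hd : 2 ≤ d) (hk : 2 ≤ k)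
    (hdk : (d, k) ≠ (2, 2)) (hf : ∀ j, Integrable (f j) (surf d))
    (hf0 : ∀ j, ¬ f j =ᵐ[surf d] 0) (hG : IsFunctionOfSum f) :
    ∃ (c : Fin k → ℂ) (ν : Fin d → ℂ), (∀ j, c j ≠ 0) ∧
      ∀ j, ∀ᵐ a ∂(surf d), f j a = c j * expDot ν a := by
  let i : Fin k := ⟨0, by lia⟩
  obtain ⟨p, hp⟩ := hG.exists_laplaceGradient_concurrent hd hk hdk hf hf0 i
  obtain ⟨c, hc⟩ := ae_eq_const_mul_expDot_of_sub_mul_laplaceGradient_comm hd (hf i) hp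
  have hc0 : c ≠ 0 := by
    rintro rfl
    exact hf0 i (by simpa only [zero_mul] using! hc)
  choose b hb hfb using hG.exists_ae_eq_const_mul hf hf0 i
  refine ⟨fun j => b j * c, -p, fun j => mul_ne_zero (hb j) hc0, fun j => ?_⟩
  filter_upwards [hfb j, hc] with a hja hia
  rw [hja, hia, mul_assoc]

theorem isFunctionOfSum_of_ae_eq_const_mul_expDot {ι : Type*} [Fintype ι] {f : ι → Sph d → ℂ}
    {c : ι → ℂ} {ν : Fin d → ℂ} (h : ∀ j, ∀ᵐ a ∂(surf d), f j a = c j * expDot ν a) :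
    IsFunctionOfSum f := by
  have hmeas : Measurable fun x : EuclideanSpace ℝ (Fin d) => (∏ j, c j) * expDot ν x :=
    (continuous_const.mul (continuous_expDot ν)).measurable
  refine (hmeas.comp (comap_measurable _)).stronglyMeasurable.aestronglyMeasurable.congr ?_
  have hall : ∀ᵐ ζ : ι → Sph d ∂(Measure.pi fun _ => surf d),
      ∀ j, f j (ζ j) = c j * expDot ν (ζ j) :=
    ae_all_iff.2 fun j => (Measure.quasiMeasurePreserving_eval (fun _ => surf d) j).ae (h j)
  filter_upwards [hall] with ζ hζ
  simp only [Function.comp_apply, hζ, Finset.prod_mul_distrib, expDot_sum]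

end Exponentials

end SphereRestriction

theorem theorem2 (d k : ℕ) (hd : 2 ≤ d) (hk : 2 ≤ k)
    (f : Fin k → SphereRestriction.Sph d → ℂ)
    (hf : ∀ j, MeasureTheory.Integrable (f j) (SphereRestriction.surf d))
    (hf0 : ∀ j, ¬ f j =ᵐ[SphereRestriction.surf d] 0) :
    SphereRestriction.prodNormSq f ≤ SphereRestriction.weightedIntegral f ∧
    ((d, k) ≠ (2, 2) → SphereRestriction.weightedIntegral f ≠ ⊤ →
      (SphereRestriction.prodNormSq f = SphereRestriction.weightedIntegral f ↔
        ∃ (c : Fin k → ℂ) (ν : Fin d → ℂ), (∀ j, c j ≠ 0) ∧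
          ∀ j, ∀ᵐ ζ ∂(SphereRestriction.surf d),
            f j ζ = c j * Complex.exp (∑ i, ν i * ((ζ : EuclideanSpace ℝ (Fin d)) i : ℂ)))) := by
  open SphereRestriction in
  exact ⟨prodNormSq_le_weightedIntegral hd hk hf, fun hdk hW =>
    (prodNormSq_eq_weightedIntegral_iff hd hk hf hW).trans
      ⟨exists_ae_eq_const_mul_expDot hd hk hdk hf hf0,
        fun ⟨_, _, _, h⟩ => isFunctionOfSum_of_ae_eq_const_mul_expDot h⟩⟩
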